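/- Let $n,k,M$ be positive integers. In the binary Hamming space $\mathbb{H}(n,2)=\{0,1\}^n$ put $\langle x,y\rangle = 1-2d(x,y)/n$, where $d$ is the Hamming distance. A $\tau$-design is a set $C\subset\mathbb{H}(n,2)$ with $|C|=\lambda 2^\tau$ for some integer $\lambda\ge 1$ such that, on every set of $\tau$ coordinates, every binary word of length $\tau$ is the restriction of exactly $\lambda$ elements of $C$. For $q=2$ the Rao bounds are $$R(n,2k)=\sum_{i=0}^{k}\binom{n}{i},\qquad R(n,2k+1)=2\sum_{i=0}^{k}\binom{n-1}{i}.$$ For $h:[-1,1)\to\mathbb{R}$ let $E(n,C;h)=\frac1{|C|}\sum_{x\ne y\in C}h(\langle x,y\rangle)$. Let $\mathcal L(n,M,2k;h)$ be the minimum of $E(n,C;h)$ over all $M$-point $2k$-designs $C\subset \mathbb{H}(n,2)$, and let $\ell=\ell(n,M,2k)$ be the minimum of $\langle x,y\rangle$ over all such designs $C$ and all distinct $x,y\in C$. Let $Q_i^{(n,2)}(t)=\binom{n}{i}^{-1}K_i^{(n,2)}\!\left(\tfrac{n(1-t)}2\right)$ with $K_i^{(n,2)}(z)=\sum_{j=0}^{i}(-1)^j\binom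 zj\binom{n-z}{i-j}$ be the normalized Krawtchouk polynomials, and for a polynomial $f=\sum_i f_iQ_i^{(n,2)}$ of degree at most $n$ let $f_0$ be the coefficient of $Q_0^{(n,2)}$. Assume that $R(n,2k)<M<R(n,2k+1)$, that there is an $M$-point $2k$-design in $\mathbb{H}(n,2)$, and that $h$ is absolutely monotone on $[-1,1)$ (that is, $h$ and all its derivatives exist and are nonnegative there). Then: 1. There are unique real numbers $-1=\beta_0<\beta_1<\dots<\beta_k<1$ and $\gamma_0,\dots,\gamma_k>0$ such that $f_0=\frac{f(1)}M+\sum_{i=0}^k\gamma_if(\beta_i)$ for every real polynomial $f$ of degree at most $2k$. 2. There is a unique real polynomial $G$ of degree at most $2k$ with $$G(\ell)=h(\ell),\qquad G(\beta_i)=h(\beta_i),\quad G'(\beta_i)=h'(\beta_i),\qquad i=1,\dots,k,$$ and it has a unique Krawtchouk expansion $G=\sum_{i=0}^{2k}G_iQ_i^{(n,2)}$. 3. We have $$\mathcal L(n,M,2k;h)\ \ge\ G_0M-G(1)\ \ge\ M\sum_{i=0}^k\gamma_ih(\beta_i),$$ and the last inequality is strict if $h$ is strictly absolutely monotone on $[-1,1)$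 (that is, $h$ and all its derivatives are positive there). -/

import Mathlib

open Polynomial

namespace HammingEnergy

/-- The binary Hamming space `H(n,2)`; its distance is Mathlib's `hammingDist`. -/
abbrev Cube (n : ℕ) : Type := Fin n → Fin 2

/-- The "inner product" `⟨x,y⟩ = 1 - 2 d(x,y) / n`. -/
noncomputable def ip {n : ℕ} (x y : Cube n) : ℝ :=
  1 - 2 * (hammingDist x y : ℝ) / (n : ℝ)

/-- `C` is a `τ`-design (an orthogonal array of strength `τ` and some index `lam ≥ 1`, without
repeated rows): `|C| = lam * 2 ^ τ`, and on every set `S` of `τ` coordinates every binary word is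
the restriction of exactly `lam` elements of `C`. -/
def IsDesign {n : ℕ} (τ : ℕ) (C : Finset (Cube n)) : Prop :=
  ∃ lam : ℕ, 0 < lam ∧ C.card = lam * 2 ^ τ ∧
    ∀ S : Finset (Fin n), S.card = τ → ∀ a : S → Fin 2,
      (C.filter (fun x => ∀ i : S, x i = a i)).card = lam

/-- The set of `M`-point `τ`-designs in `H(n,2)`. -/
def designs (n M τ : ℕ) : Set (Finset (Cube n)) :=
  {C | IsDesign τ C ∧ C.card = M}

/-- The `h`-energy `E(n,C;h) = |C|⁻¹ ∑_{x,y ∈ C, x ≠ y} h(⟨x,y⟩)`. -/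
noncomputable def energy {n : ℕ} (h : ℝ → ℝ) (C : Finset (Cube n)) : ℝ :=
  (1 / (C.card : ℝ)) * ∑ p ∈ C.offDiag, h (ip p.1 p.2)

/-- `𝓛(n,M,τ;h)`: the minimum energy of the `M`-point `τ`-designs in `H(n,2)`, equal to `+∞` if
there are none. -/
noncomputable def minDesignEnergy (n M τ : ℕ) (h : ℝ → ℝ) : EReal :=
  ⨅ C ∈ designs n M τ, (energy h C : EReal)

/-- `ℓ(C)`: the minimum of `⟨x,y⟩` over distinct `x, y ∈ C` (for `|C| ≥ 2`). -/
noncomputable def minIp {n : ℕ} (C : Finset (Cube n)) : ℝ :=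
  sInf {t : ℝ | ∃ x ∈ C, ∃ y ∈ C, x ≠ y ∧ t = ip x y}

/-- `ℓ(n,M,τ)`: the minimum of `ℓ(C)` over the `M`-point `τ`-designs `C` in `H(n,2)` (meaningful
when there is one and `M ≥ 2`). -/
noncomputable def designMinIp (n M τ : ℕ) : ℝ :=
  sInf (minIp '' designs n M τ)

/-- The Rao bound `R(n,τ)` for `q = 2`: `∑_{i ≤ k} (n choose i)` if `τ = 2k`, and
`2 ∑_{i ≤ k-1} (n-1 choose i)` if `τ = 2k-1`. -/
def rao (n τ : ℕ) : ℕ :=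
  if Even τ then ∑ i ∈ Finset.range (τ / 2 + 1), n.choose i
  else 2 * ∑ i ∈ Finset.range ((τ + 1) / 2), (n - 1).choose i

/-- The binomial coefficient `(p choose j) = p (p-1) ⋯ (p-j+1) / j!` of a polynomial `p`. -/
noncomputable def polyChoose (p : ℝ[X]) (j : ℕ) : ℝ[X] :=
  C (1 / (j.factorial : ℝ)) * ∏ m ∈ Finset.range j, (p - C (m : ℝ))

/-- The Krawtchouk polynomial `K_i^{(n,2)}(z) = ∑_j (-1)^j (z choose j) (n-z choose i-j)`. -/
noncomputable def kraw (n i : ℕ) : ℝ[X] :=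
  ∑ j ∈ Finset.range (i + 1),
    (-1) ^ j * polyChoose X j * polyChoose (C (n : ℝ) - X) (i - j)

/-- The normalized Krawtchouk polynomial `Q_i^{(n,2)}(t) = K_i^{(n,2)}(z) / (n choose i)`,
`z = n (1-t) / 2`. -/
noncomputable def normKraw (n i : ℕ) : ℝ[X] :=
  C (1 / (n.choose i : ℝ)) * (kraw n i).comp (C ((n : ℝ) / 2) * (1 - X))

/-- `c` is the list of coefficients of an expansion `f = ∑_{i=0}^{m} c_i Q_i^{(n,2)}`. -/
def IsKrawExpansion (n : ℕ) {m : ℕ} (f : ℝ[X]) (c : Fin (m + 1) → ℝ) : Prop :=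
  f = ∑ i : Fin (m + 1), C (c i) * normKraw n i

/-- The nodes `-1 = β_0 < β_1 < ⋯ < β_k < 1` and the weights `γ_0, …, γ_k > 0` satisfy
`f_0 = f(1) / M + ∑_{i=0}^{k} γ_i f(β_i)` for every real polynomial `f` of degree at most `2k`,
where `f_0` is the constant coefficient of the Krawtchouk expansion of `f`. -/
structure IsQuadrature (n M k : ℕ) (β γ : Fin (k + 1) → ℝ) : Prop where
  zero_node : β 0 = -1
  strictMono : StrictMono β
  lt_one : ∀ i, β i < 1
  weight_pos : ∀ i, 0 < γ i
  exact : ∀ (f : ℝ[X]) (c : Fin (2 * k + 1) → ℝ), f.natDegree ≤ 2 * k → IsKrawExpansion n f c →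
    c 0 = f.eval 1 / (M : ℝ) + ∑ i, γ i * f.eval (β i)

/-- `G` is a polynomial of degree at most `2k` with `G(l) = h(l)`, and `G(β_i) = h(β_i)`,
`G'(β_i) = h'(β_i)` for `i = 1, …, k`. -/
structure IsHermite {k : ℕ} (h : ℝ → ℝ) (l : ℝ) (β : Fin (k + 1) → ℝ) (G : ℝ[X]) : Prop where
  natDegree_le : G.natDegree ≤ 2 * k
  eval_left : G.eval l = h l
  eval_node : ∀ i : Fin k, G.eval (β i.succ) = h (β i.succ)
  deriv_node : ∀ i : Fin k, (derivative G).eval (β i.succ) = deriv h (β i.succ)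

/-- All derivatives of `h` (including `h` itself) exist and are positive on `s`. -/
def StrictlyAbsolutelyMonotoneOn (h : ℝ → ℝ) (s : Set ℝ) : Prop :=
  ContDiffOn ℝ (⊤ : ℕ∞) h s ∧ ∀ m : ℕ, ∀ t ∈ s, 0 < iteratedDerivWithin m h s t

end HammingEnergy

open HammingEnergy

/-!
By discrete harmonic analysis on the cube, a polynomial `f` of degree at most `2k` satisfies
`∑ y ∈ D, f(⟨x,y⟩) = |D| f_0` for every point `x` and every `2k`-design `D`. For `x ∈ D` the
functional `L f = f_0 - f(1) / M` is therefore integration against a positive measure on the inner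
products `⟨x,y⟩` with `y ∈ D`, `y ≠ x`. There are more than `k` of these: a polynomial of degree at
most `k` that vanishes at all of them would give equality in the Rao bound `R(n,2k)`. So `L` has a
unique Gauss–Radau rule with fixed node `-1`; this is the quadrature with nodes `β` and weights `γ`.

Applying `L` to `(t - β_i) ∏_{j ≠ i} (t - β_j)²`, whose quadrature sum is at most zero, yields an
inner product smaller than `β_i`, so `ℓ < β_i` for `i ≥ 1`. Moreover `ℓ > -1` when `M < R(n,2k+1)`:
the reproducing kernel of the `Q_i` with `i ≤ k` and `i ≡ k` mod `2` shows that a `2k`-design with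
two antipodal points has at least `R(n,2k+1)` elements.

By the error formula for Hermite interpolation, `h - G` is a nonnegative multiple of
`(t - ℓ) ∏ (t - β_i)²`. Hence `G ≤ h` at all inner products of an `M`-point design `D`, where the
energy of `G` is exactly `G_0 M - G(1)`, and `h(-1) ≤ G(-1)` with equality at the other nodes, so
that the quadrature formula for `G` gives the second bound.
-/

namespace HammingEnergy

/-! ### Walsh characters and Krawtchouk polynomials -/

/-- The Walsh character `x ↦ ∏_{i ∈ S} (-1) ^ (x i)` of the binary Hamming space. -/
noncomputable def walsh {n : ℕ} (S : Finset (Fin n)) (x : Cube n) : ℝ :=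
  ∏ i ∈ S, (-1 : ℝ) ^ (x i : ℕ)

section Walsh

variable {n : ℕ} (S T : Finset (Fin n)) (x y : Cube n)

lemma walsh_mul_self : walsh S x * walsh S x = 1 := by
  simp only [walsh, ← Finset.prod_mul_distrib, ← mul_pow, neg_mul_neg, one_mul, one_pow,
    Finset.prod_const_one]

lemma walsh_mul_walsh : walsh S x * walsh T x = walsh (symmDiff S T) x := by
  have split (A B : Finset (Fin n)) : walsh A x = walsh (A ∩ B) x * walsh (A \ B) x :=
    (Finset.prod_inter_mul_prod_sdiff A B _).symm
  have union : walsh (symmDiff S T) x = walsh (S \ T) x * walsh (T \ S) x :=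
    Finset.prod_union disjoint_sdiff_sdiff
  rw [split S T, split T S, union, Finset.inter_comm T S]
  linear_combination (walsh (S \ T) x * walsh (T \ S) x) * walsh_mul_self (S ∩ T) x

lemma walsh_mul_walsh_eq_prod :
    walsh S x * walsh S y = ∏ i ∈ S, if x i = y i then (1 : ℝ) else -1 := by
  have sign (a b : Fin 2) :
      (-1 : ℝ) ^ (a : ℕ) * (-1) ^ (b : ℕ) = if a = b then 1 else -1 := by
    fin_cases a <;> fin_cases b <;> simp
  simp only [walsh, ← Finset.prod_mul_distrib, sign]

end Walsh

lemma eval_polyChoose {p : ℝ[X]} {t : ℝ} {d : ℕ} (h : p.eval t = d) (j : ℕ) :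
    (polyChoose p j).eval t = d.choose j := by
  simp only [polyChoose, eval_mul, eval_C, eval_prod, eval_sub, h]
  rw [← descPochhammer_eval_eq_prod_range, descPochhammer_eval_eq_descFactorial,
    Nat.descFactorial_eq_factorial_mul_choose, Nat.cast_mul, one_div,
    inv_mul_cancel_left₀ (by positivity)]

lemma eval_kraw_natCast {n d : ℕ} (hd : d ≤ n) (i : ℕ) :
    (kraw n i).eval (d : ℝ) =
      ∑ j ∈ Finset.range (i + 1), (-1) ^ j * (d.choose j : ℝ) * ((n - d).choose (i - j) : ℝ) := by
  simp only [kraw, eval_finsetSum, eval_mul, eval_pow, eval_neg, eval_one]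
  refine Finset.sum_congr rfl fun j _ => ?_
  rw [eval_polyChoose eval_X, eval_polyChoose (d := n - d) (by simp [Nat.cast_sub hd])]

lemma coeff_one_sub_X_pow (d j : ℕ) : ((1 - X : ℝ[X]) ^ d).coeff j = (-1) ^ j * d.choose j := by
  have h : (1 - X : ℝ[X]) = (1 + X : ℝ[X]).comp (C (-1) * X) := by simp [sub_eq_add_neg]
  rw [h, ← pow_comp, comp_C_mul_X_coeff, coeff_one_add_X_pow, mul_comm]

lemma eval_kraw_eq_coeff {n d : ℕ} (hd : d ≤ n) (i : ℕ) :
    (kraw n i).eval (d : ℝ) = ((1 - X : ℝ[X]) ^ d * (1 + X) ^ (n - d)).coeff i := by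
  simp only [eval_kraw_natCast hd, coeff_mul, Finset.Nat.sum_antidiagonal_eq_sum_range_succ_mk,
    coeff_one_sub_X_pow, coeff_one_add_X_pow]

section Zonal

variable {n : ℕ} (i : ℕ) (x y : Cube n)

lemma hammingDist_le : hammingDist x y ≤ n := by
  simpa using hammingDist_le_card_fintype (x := x) (y := y)

lemma prod_one_add_sign_mul_X :
    ∏ i : Fin n, (1 + C (if x i = y i then (1 : ℝ) else -1) * X) =
      (1 - X) ^ hammingDist x y * (1 + X) ^ (n - hammingDist x y) := by
  have card_agree : (Finset.univ.filter fun i => ¬ x i ≠ y i).card = n - hammingDist x y := by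
    have := Finset.card_filter_add_card_filter_not (s := Finset.univ) (fun i => x i ≠ y i)
    rw [Finset.card_univ, Fintype.card_fin] at this
    exact Nat.eq_sub_of_add_eq' this
  rw [← Finset.prod_filter_mul_prod_filter_not Finset.univ (fun i => x i ≠ y i), ← card_agree,
    hammingDist, ← Finset.prod_const, ← Finset.prod_const]
  congr 1 <;> refine Finset.prod_congr rfl fun i hi => ?_
  · rw [if_neg (Finset.mem_filter.1 hi).2, C_neg, C_1, neg_one_mul, sub_eq_add_neg]
  · rw [if_pos (not_not.1 (Finset.mem_filter.1 hi).2), C_1, one_mul]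

lemma eval_kraw_hammingDist :
    (kraw n i).eval (hammingDist x y : ℝ) =
      ∑ S ∈ Finset.powersetCard i Finset.univ, walsh S x * walsh S y := by
  rw [eval_kraw_eq_coeff (hammingDist_le x y), ← prod_one_add_sign_mul_X, Finset.prod_one_add,
    finsetSum_coeff, Finset.powersetCard_eq_filter, Finset.sum_filter]
  refine Finset.sum_congr rfl fun S _ => ?_
  rw [Finset.prod_mul_distrib, Finset.prod_const, ← map_prod, coeff_C_mul_X_pow,
    walsh_mul_walsh_eq_prod]
  simp only [eq_comm]

lemma eval_normKraw_ip :
    (normKraw n i).eval (ip x y) = 1 / (n.choose i : ℝ) *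
      ∑ S ∈ Finset.powersetCard i Finset.univ, walsh S x * walsh S y := by
  have hdist : (n : ℝ) / 2 * (1 - ip x y) = hammingDist x y := by
    rcases n.eq_zero_or_pos with rfl | hn
    · simp [Subsingleton.elim x y]
    · rw [ip]
      field_simp
      ring
  simp only [normKraw, eval_mul, eval_C, eval_comp, eval_sub, eval_one, eval_X, hdist,
    eval_kraw_hammingDist]

lemma ip_self : ip x x = 1 := by simp [ip]

lemma ip_comm : ip x y = ip y x := by rw [ip, ip, hammingDist_comm]

end Zonal

lemma eval_normKraw_one {n i : ℕ} (hi : i ≤ n) : (normKraw n i).eval 1 = 1 := by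
  have h := eval_normKraw_ip i (0 : Cube n) 0
  rw [ip_self] at h
  have hpos : (n.choose i : ℝ) ≠ 0 := by exact_mod_cast (Nat.choose_pos hi).ne'
  simpa only [h, walsh_mul_self, Finset.sum_const, Finset.card_powersetCard, Finset.card_univ,
    Fintype.card_fin, nsmul_one] using one_div_mul_cancel hpos

lemma eval_normKraw_neg_one {n i : ℕ} (hi : i ≤ n) : (normKraw n i).eval (-1) = (-1) ^ i := by
  have hpos : (n.choose i : ℝ) ≠ 0 := by exact_mod_cast (Nat.choose_pos hi).ne'
  have hn : (n : ℝ) / 2 * (1 - -1) = n := by ring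
  simp only [normKraw, eval_mul, eval_C, eval_comp, eval_sub, eval_one, eval_X, hn,
    eval_kraw_eq_coeff le_rfl, Nat.sub_self, pow_zero, mul_one, coeff_one_sub_X_pow]
  field_simp

namespace IsDesign

variable {n τ : ℕ} {D : Finset (Cube n)}

lemma card_pos (hD : IsDesign τ D) : 0 < D.card := by
  obtain ⟨lam, hlam, hcard, -⟩ := hD
  rw [hcard]
  positivity

lemma strength_le (hD : IsDesign τ D) : τ ≤ n := by
  obtain ⟨lam, hlam, hcard, -⟩ := hD
  refine (Nat.pow_le_pow_iff_right one_lt_two).1 ?_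
  calc 2 ^ τ ≤ lam * 2 ^ τ := Nat.le_mul_of_pos_left _ hlam
    _ = D.card := hcard.symm
    _ ≤ 2 ^ n := by simpa using D.card_le_univ

lemma exists_sum_restrict_eq (hD : IsDesign τ D) {T : Finset (Fin n)} (hT : T.card = τ)
    (g : (T → Fin 2) → ℝ) : ∃ lam : ℕ, ∑ x ∈ D, g (fun i => x i) = lam * ∑ a, g a := by
  obtain ⟨lam, -, -, h⟩ := hD
  refine ⟨lam, ?_⟩
  rw [← Finset.sum_fiberwise D (fun x => fun i : T => x i), Finset.mul_sum]
  refine Finset.sum_congr rfl fun a _ => ?_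
  have fiber : (D.filter fun x => (fun i : T => x i) = a) = D.filter fun x => ∀ i : T, x i = a i :=
    Finset.filter_congr fun x _ => funext_iff
  rw [Finset.sum_congr rfl fun x hx => congrArg g (Finset.mem_filter.1 hx).2, Finset.sum_const,
    nsmul_eq_mul, fiber, h T hT a]

lemma sum_walsh_eq_zero (hD : IsDesign τ D) {S : Finset (Fin n)} (hS : S.Nonempty)
    (hSτ : S.card ≤ τ) : ∑ x ∈ D, walsh S x = 0 := by
  obtain ⟨T, hST, -, hT⟩ := Finset.exists_subsuperset_card_eq (Finset.subset_univ S) hSτ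
    (by simpa using hD.strength_le)
  obtain ⟨lam, h⟩ := hD.exists_sum_restrict_eq hT
    (fun a => ∏ i : T, if (i : Fin n) ∈ S then (-1 : ℝ) ^ (a i : ℕ) else 1)
  have walsh_eq (x : Cube n) :
      (∏ i : T, if (i : Fin n) ∈ S then (-1 : ℝ) ^ (x i : ℕ) else 1) = walsh S x := by
    rw [Finset.prod_coe_sort T (fun i => if i ∈ S then (-1 : ℝ) ^ (x i : ℕ) else 1),
      ← Finset.prod_filter, Finset.filter_mem_eq_inter, Finset.inter_eq_right.2 hST, walsh]
  obtain ⟨s, hs⟩ := hS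
  rw [← Finset.sum_congr rfl fun x _ => walsh_eq x, h,
    ← Fintype.prod_sum fun (i : T) (b : Fin 2) => if (i : Fin n) ∈ S then (-1 : ℝ) ^ (b : ℕ) else 1,
    Finset.prod_eq_zero (Finset.mem_univ ⟨s, hST hs⟩) (by simp [hs]), mul_zero]

lemma sum_walsh_mul_walsh (hD : IsDesign τ D) {S T : Finset (Fin n)} (hST : S.card + T.card ≤ τ) :
    ∑ x ∈ D, walsh S x * walsh T x = if S = T then (D.card : ℝ) else 0 := by
  split_ifs with h
  · simp only [h, walsh_mul_self, Finset.sum_const, nsmul_one]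
  · simp only [walsh_mul_walsh]
    have hne : (symmDiff S T).Nonempty :=
      Finset.nonempty_iff_ne_empty.2 fun h0 => h (symmDiff_eq_bot.1 h0)
    refine hD.sum_walsh_eq_zero hne ?_
    calc (symmDiff S T).card ≤ (S ∪ T).card := Finset.card_le_card symmDiff_le_sup
      _ ≤ S.card + T.card := Finset.card_union_le S T
      _ ≤ τ := hST

lemma sum_normKraw_mul_normKraw (hD : IsDesign τ D) {i j : ℕ} (hij : i + j ≤ τ) (x z : Cube n) :
    ∑ y ∈ D, (normKraw n i).eval (ip x y) * (normKraw n j).eval (ip y z) =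
      if i = j then D.card / (n.choose i : ℝ) * (normKraw n i).eval (ip x z) else 0 := by
  have hsum : ∑ y ∈ D, (∑ S ∈ Finset.powersetCard i Finset.univ, walsh S x * walsh S y) *
        (∑ T ∈ Finset.powersetCard j Finset.univ, walsh T y * walsh T z) =
      ∑ S ∈ Finset.powersetCard i Finset.univ, ∑ T ∈ Finset.powersetCard j Finset.univ,
        if S = T then D.card * (walsh S x * walsh T z) else 0 := by
    simp only [Finset.sum_mul_sum]
    rw [Finset.sum_comm]
    refine Finset.sum_congr rfl fun S hS => ?_
    rw [Finset.sum_comm]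
    refine Finset.sum_congr rfl fun T hT => ?_
    rw [Finset.mem_powersetCard_univ] at hS hT
    have := hD.sum_walsh_mul_walsh (S := S) (T := T) (by rwa [hS, hT])
    rw [Finset.sum_congr rfl fun y _ => (by ring : walsh S x * walsh S y * (walsh T y * walsh T z) =
      walsh S y * walsh T y * (walsh S x * walsh T z)), ← Finset.sum_mul, this, ite_mul, zero_mul]
  simp only [eval_normKraw_ip, mul_mul_mul_comm _ (∑ _ ∈ _, _), ← Finset.mul_sum, hsum,
    Finset.sum_ite_eq]
  split_ifs with h
  · subst h
    rw [Finset.sum_congr rfl fun _ hS => if_pos hS, ← Finset.mul_sum]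
    ring
  · rw [Finset.sum_congr rfl fun S hS => if_neg ?_]
    · simp
    · rw [Finset.mem_powersetCard_univ] at hS ⊢
      rwa [hS]

end IsDesign

/-! ### Krawtchouk expansions and the Rao bounds -/

lemma mem_degreeLT_succ {R : Type*} [Semiring R] {m : ℕ} {p : R[X]} :
    p ∈ degreeLT R (m + 1) ↔ p.natDegree ≤ m := by
  rw [mem_degreeLT, degree_lt_iff_coeff_zero, natDegree_le_iff_coeff_eq_zero]
  rfl

theorem existsUnique_eq_sum_C_mul {K : Type*} [Field K] {m : ℕ} {Q : ℕ → K[X]}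
    (hQ : ∀ i ≤ m, (Q i).degree = i) {f : K[X]} (hf : f.natDegree ≤ m) :
    ∃! c : Fin (m + 1) → K, f = ∑ i, C (c i) * Q i := by
  let S : Polynomial.Sequence K :=
    { elems' := fun i => if i ≤ m then Q i else X ^ i
      degree_eq' := fun i => by
        split_ifs with h
        · exact hQ i h
        · exact degree_X_pow i }
  have S_eq (i : Fin (m + 1)) : S i = Q i := if_pos (Nat.lt_succ_iff.1 i.is_lt)
  let v (i : Fin (m + 1)) : degreeLT K (m + 1) := ⟨Q i, by
    rw [mem_degreeLT, hQ i (Nat.lt_succ_iff.1 i.is_lt)]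
    exact_mod_cast i.is_lt⟩
  have v_indep : LinearIndependent K v := by
    refine LinearIndependent.of_comp (degreeLT K (m + 1)).subtype ?_
    have h := S.linearIndependent.comp _ (Fin.val_injective (n := m + 1))
    simp only [Function.comp_def, S_eq] at h
    exact h
  let b := basisOfLinearIndependentOfCardEqFinrank v_indep
    (by rw [(degreeLTEquiv K (m + 1)).finrank_eq, Module.finrank_fin_fun, Fintype.card_fin])
  have hb (c : Fin (m + 1) → K) :
      b.equivFun.symm c = ⟨f, mem_degreeLT_succ.2 hf⟩ ↔ f = ∑ i, C (c i) * Q i := by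
    rw [Module.Basis.equivFun_symm_apply, Subtype.ext_iff, eq_comm]
    simp [b, v, smul_eq_C_mul]
  simpa only [hb] using b.equivFun.symm.bijective.existsUnique ⟨f, mem_degreeLT_succ.2 hf⟩

lemma natDegree_polyChoose_le {p : ℝ[X]} (hp : p.natDegree ≤ 1) (j : ℕ) :
    (polyChoose p j).natDegree ≤ j := by
  refine (natDegree_C_mul_le _ _).trans ((natDegree_prod_le _ _).trans ?_)
  calc ∑ m ∈ Finset.range j, (p - C (m : ℝ)).natDegree ≤ (Finset.range j).card • 1 :=
        Finset.sum_le_card_nsmul _ _ 1 fun m _ => natDegree_sub_C.trans_le hp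
    _ = j := by rw [Finset.card_range, nsmul_one, Nat.cast_id]

lemma coeff_polyChoose {p : ℝ[X]} (hp : p.natDegree ≤ 1) (j : ℕ) :
    (polyChoose p j).coeff j = 1 / (j.factorial : ℝ) * p.coeff 1 ^ j := by
  have hprod := coeff_prod_of_natDegree_le (Finset.range j) (fun m => p - C (m : ℝ)) 1
    fun m _ => natDegree_sub_C.trans_le hp
  rw [Finset.card_range, mul_one] at hprod
  simp only [polyChoose, coeff_C_mul, hprod, coeff_sub, coeff_C_succ, sub_zero, Finset.prod_const,
    Finset.card_range]

lemma natDegree_C_sub_X (a : ℝ) : (C a - X : ℝ[X]).natDegree = 1 := by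
  rw [← natDegree_neg, neg_sub, natDegree_X_sub_C]

lemma natDegree_kraw_le (n i : ℕ) : (kraw n i).natDegree ≤ i := by
  refine natDegree_sum_le_of_forall_le _ _ fun j hj => ?_
  have hji : j ≤ i := Nat.lt_succ_iff.1 (Finset.mem_range.1 hj)
  calc _ ≤ 0 + j + (i - j) :=
        natDegree_mul_le_of_le
          (natDegree_mul_le_of_le (by simp : ((-1 : ℝ[X]) ^ j).natDegree ≤ 0)
            (natDegree_polyChoose_le natDegree_X_le j))
          (natDegree_polyChoose_le (natDegree_C_sub_X _).le (i - j))
    _ = i := by lia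

lemma coeff_kraw_self (n i : ℕ) :
    (kraw n i).coeff i = (-1) ^ i * ∑ j ∈ Finset.range (i + 1),
      1 / ((j.factorial : ℝ) * (i - j).factorial) := by
  rw [kraw, finsetSum_coeff, Finset.mul_sum]
  refine Finset.sum_congr rfl fun j hj => ?_
  have hji : j ≤ i := Nat.lt_succ_iff.1 (Finset.mem_range.1 hj)
  have hprod := coeff_mul_add_eq_of_natDegree_le
    (natDegree_polyChoose_le (natDegree_X_le (R := ℝ)) j)
    (natDegree_polyChoose_le (natDegree_C_sub_X (n : ℝ)).le (i - j))
  rw [Nat.add_sub_cancel' hji, coeff_polyChoose natDegree_X_le,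
    coeff_polyChoose (natDegree_C_sub_X _).le] at hprod
  have hneg : ((-1 : ℝ[X]) ^ j) = C ((-1) ^ j) := by simp
  have hsign : (-1 : ℝ) ^ i = (-1) ^ j * (-1) ^ (i - j) := by
    rw [← pow_add, Nat.add_sub_cancel' hji]
  rw [mul_assoc, hneg, coeff_C_mul, hprod, hsign]
  simp only [coeff_X_one, coeff_sub, coeff_C_succ, zero_sub]
  ring

lemma natDegree_kraw (n i : ℕ) : (kraw n i).natDegree = i := by
  refine (natDegree_kraw_le n i).antisymm (le_natDegree_of_ne_zero ?_)
  rw [coeff_kraw_self]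
  exact mul_ne_zero (pow_ne_zero _ (by norm_num))
    (Finset.sum_pos (fun j _ => by positivity) ⟨0, by simp⟩).ne'

lemma degree_normKraw {n i : ℕ} (hi : i ≤ n) : (normKraw n i).degree = i := by
  have hne : normKraw n i ≠ 0 := fun h => by simpa [h] using eval_normKraw_one hi
  have hchoose : 1 / (n.choose i : ℝ) ≠ 0 :=
    one_div_ne_zero (Nat.cast_ne_zero.2 (Nat.choose_pos hi).ne')
  rw [degree_eq_iff_natDegree_eq hne, normKraw, natDegree_C_mul hchoose, natDegree_comp,
    natDegree_kraw]
  rcases n.eq_zero_or_pos with rfl | hn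
  · rw [Nat.le_zero.1 hi, zero_mul]
  · rw [natDegree_C_mul (by positivity), ← C_1, natDegree_C_sub_X, mul_one]

theorem existsUnique_isKrawExpansion {n m : ℕ} (hm : m ≤ n) {f : ℝ[X]} (hf : f.natDegree ≤ m) :
    ∃! c : Fin (m + 1) → ℝ, IsKrawExpansion n f c :=
  existsUnique_eq_sum_C_mul (fun _ hi => degree_normKraw (hi.trans hm)) hf

lemma IsKrawExpansion.eval_one {n m : ℕ} (hm : m ≤ n) {f : ℝ[X]} {c : Fin (m + 1) → ℝ}
    (hf : IsKrawExpansion n f c) : f.eval 1 = ∑ i, c i := by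
  rw [hf, eval_finsetSum]
  refine Finset.sum_congr rfl fun i _ => ?_
  rw [eval_C_mul, eval_normKraw_one (by lia), mul_one]

/-- The zonal polynomial `∑_{i ∈ I} (n choose i) Q_i`: on a design of sufficient strength it is the
reproducing kernel of the span of the `Q_i` with `i ∈ I`. -/
noncomputable def reproKernel (n : ℕ) (I : Finset ℕ) : ℝ[X] :=
  ∑ i ∈ I, C (n.choose i : ℝ) * normKraw n i

section ReproKernel

variable {n : ℕ} {I : Finset ℕ} (hI : ∀ i ∈ I, i ≤ n)
include hI

lemma eval_reproKernel_one : (reproKernel n I).eval 1 = ∑ i ∈ I, (n.choose i : ℝ) := by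
  rw [reproKernel, eval_finsetSum]
  refine Finset.sum_congr rfl fun i hi => ?_
  rw [eval_C_mul, eval_normKraw_one (hI i hi), mul_one]

lemma eval_reproKernel_neg_one :
    (reproKernel n I).eval (-1) = ∑ i ∈ I, (n.choose i : ℝ) * (-1) ^ i := by
  rw [reproKernel, eval_finsetSum]
  refine Finset.sum_congr rfl fun i hi => ?_
  rw [eval_C_mul, eval_normKraw_neg_one (hI i hi)]

end ReproKernel

namespace IsDesign

variable {n τ : ℕ} {D : Finset (Cube n)}

lemma sum_reproKernel_mul_normKraw (hD : IsDesign τ D) {I : Finset ℕ} {j : ℕ}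
    (hI : ∀ i ∈ I, i + j ≤ τ) (x : Cube n) :
    ∑ y ∈ D, (reproKernel n I).eval (ip x y) * (normKraw n j).eval (ip x y) =
      if j ∈ I then (D.card : ℝ) else 0 := by
  simp only [reproKernel, eval_finsetSum, eval_mul, eval_C, Finset.sum_mul]
  rw [Finset.sum_comm, ← Finset.sum_ite_eq' I j fun _ => (D.card : ℝ)]
  refine Finset.sum_congr rfl fun i hi => ?_
  have hin : i ≤ n := (Nat.le_add_right i j).trans ((hI i hi).trans hD.strength_le)
  have hchoose : (n.choose i : ℝ) ≠ 0 := Nat.cast_ne_zero.2 (Nat.choose_pos hin).ne'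
  have horth := hD.sum_normKraw_mul_normKraw (hI i hi) x x
  simp only [ip_comm _ x, ip_self, eval_normKraw_one hin] at horth
  simp only [mul_assoc, ← Finset.mul_sum, horth]
  split_ifs
  · field_simp
  · rw [mul_zero]

lemma sum_sq_reproKernel (hD : IsDesign τ D) {I : Finset ℕ} (hI : ∀ i ∈ I, 2 * i ≤ τ)
    (x : Cube n) :
    ∑ y ∈ D, (reproKernel n I).eval (ip x y) ^ 2 = D.card * ∑ i ∈ I, (n.choose i : ℝ) := by
  calc ∑ y ∈ D, (reproKernel n I).eval (ip x y) ^ 2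
      = ∑ y ∈ D, ∑ j ∈ I, n.choose j *
          ((reproKernel n I).eval (ip x y) * (normKraw n j).eval (ip x y)) := by
        refine Finset.sum_congr rfl fun y _ => ?_
        rw [sq]
        nth_rw 2 [reproKernel]
        simp only [eval_finsetSum, eval_mul, eval_C, Finset.mul_sum, mul_left_comm]
    _ = ∑ j ∈ I, n.choose j * (D.card : ℝ) := by
        rw [Finset.sum_comm]
        refine Finset.sum_congr rfl fun j hj => ?_
        rw [← Finset.mul_sum, hD.sum_reproKernel_mul_normKraw
          (fun i hi => by have := hI i hi; have := hI j hj; lia), if_pos hj]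
    _ = D.card * ∑ i ∈ I, (n.choose i : ℝ) := by rw [← Finset.sum_mul, mul_comm]

lemma sum_reproKernel_mul (hD : IsDesign τ D) {I : Finset ℕ} {m : ℕ} (hI : ∀ i ∈ I, i + m ≤ τ)
    {f : ℝ[X]} {c : Fin (m + 1) → ℝ} (hf : IsKrawExpansion n f c) (x : Cube n) :
    ∑ y ∈ D, (reproKernel n I).eval (ip x y) * f.eval (ip x y) =
      D.card * ∑ j : Fin (m + 1), if (j : ℕ) ∈ I then c j else 0 := by
  have hsum (j : Fin (m + 1)) :=
    hD.sum_reproKernel_mul_normKraw (j := j) (fun i hi => (by have := hI i hi; lia)) x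
  rw [hf, Finset.mul_sum]
  simp only [eval_finsetSum, eval_mul, eval_C, Finset.mul_sum]
  rw [Finset.sum_comm]
  refine Finset.sum_congr rfl fun j _ => ?_
  simp only [mul_left_comm _ (c j), ← Finset.mul_sum, hsum, mul_ite, mul_zero]
  simp only [mul_comm]

lemma sum_eval_ip (hD : IsDesign τ D) {f : ℝ[X]} {c : Fin (τ + 1) → ℝ}
    (hf : IsKrawExpansion n f c) (x : Cube n) : ∑ y ∈ D, f.eval (ip x y) = D.card * c 0 := by
  have kernel_eq_one : reproKernel n {0} = 1 := by
    simp [reproKernel, normKraw, kraw, polyChoose]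
  have h := hD.sum_reproKernel_mul (I := {0}) (by simp) hf x
  simpa only [kernel_eq_one, eval_one, one_mul, Finset.mem_singleton, Fin.val_eq_zero_iff,
    Finset.sum_ite_eq', Finset.mem_univ, if_true] using h

end IsDesign

lemma rao_two_mul (n k : ℕ) : rao n (2 * k) = ∑ i ∈ Finset.range (k + 1), n.choose i := by
  rw [rao, if_pos (even_two_mul k), Nat.mul_div_cancel_left k two_pos]

lemma rao_two_mul_add_one (n k : ℕ) :
    rao n (2 * k + 1) = 2 * ∑ i ∈ Finset.range (k + 1), (n - 1).choose i := by
  rw [rao, if_neg (by simp), Nat.add_assoc, ← Nat.mul_succ, Nat.mul_div_cancel_left _ two_pos]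

lemma sum_choose_same_parity (n k : ℕ) :
    ∑ i ∈ (Finset.range (k + 1)).filter (fun i => Even (i + k)), (n + 1).choose i =
      ∑ i ∈ Finset.range (k + 1), n.choose i := by
  induction k using Nat.twoStepInduction with
  | zero => simp [Finset.filter_singleton]
  | one =>
    simp [Finset.sum_filter, Finset.sum_range_succ, Nat.even_add_one]; lia
  | more k ih _ =>
    have h_odd : ¬ Even (k + 1 + (k + 2)) := Nat.not_even_iff_odd.2 ⟨k + 1, by ring⟩
    have h_even : Even (k + 2 + (k + 2)) := ⟨k + 2, rfl⟩
    rw [Finset.sum_filter] at ih ⊢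
    rw [Finset.sum_range_succ, Finset.sum_range_succ, Finset.sum_range_succ _ (k + 2),
      Finset.sum_range_succ _ (k + 1), ← ih]
    simp only [h_odd, h_even, if_true, if_false, Nat.even_add, even_two, iff_true,
      Nat.choose_succ_succ' n (k + 1)]
    ring

namespace IsDesign

variable {n k : ℕ} {D : Finset (Cube n)}

theorem card_eq_rao_of_eval_eq_zero (hD : IsDesign (2 * k) D) {x : Cube n} (hx : x ∈ D) {f : ℝ[X]}
    (hf : f.natDegree ≤ k) (hf1 : f.eval 1 ≠ 0) (h0 : ∀ y ∈ D, y ≠ x → f.eval (ip x y) = 0) :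
    D.card = rao n (2 * k) := by
  have hkn : 2 * k ≤ n := hD.strength_le
  obtain ⟨c, hc, -⟩ := existsUnique_isKrawExpansion (by lia : k ≤ n) hf
  have hI : ∀ i ∈ Finset.range (k + 1), i ≤ k := fun i hi =>
    Nat.lt_succ_iff.1 (Finset.mem_range.1 hi)
  have hrepro := hD.sum_reproKernel_mul (fun i hi => (by have := hI i hi; lia)) hc x
  rw [Finset.sum_eq_single_of_mem x hx fun y hy hyx => by rw [h0 y hy hyx, mul_zero], ip_self,
    eval_reproKernel_one fun i hi => (by have := hI i hi; lia)] at hrepro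
  simp only [Finset.mem_range, Fin.is_lt, if_true, ← hc.eval_one (by lia)] at hrepro
  rw [rao_two_mul]
  exact_mod_cast (mul_right_cancel₀ hf1 hrepro).symm

lemma two_mul_sum_choose_le_card_of_antipodal (hD : IsDesign (2 * k) D) {x y : Cube n}
    (hx : x ∈ D) (hy : y ∈ D) (hxy : ip x y = -1) {I : Finset ℕ}
    (hI : ∀ i ∈ I, i ≤ k ∧ Even (i + k)) : 2 * ∑ i ∈ I, n.choose i ≤ D.card := by
  have hne : x ≠ y := fun h => by norm_num [h, ip_self] at hxy
  have hkn : 2 * k ≤ n := hD.strength_le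
  have hIn : ∀ i ∈ I, i ≤ n := fun i hi => by have := (hI i hi).1; lia
  set s : ℝ := ∑ i ∈ I, (n.choose i : ℝ) with hs
  have kernel_one : (reproKernel n I).eval (ip x x) = s := by rw [ip_self, eval_reproKernel_one hIn]
  have kernel_antipode : (reproKernel n I).eval (ip x y) = s * (-1) ^ k := by
    rw [hxy, eval_reproKernel_neg_one hIn, hs, Finset.sum_mul]
    refine Finset.sum_congr rfl fun i hi => ?_
    rw [neg_one_pow_congr (Nat.even_add.1 (hI i hi).2)]
  have two_mul_sq_le : 2 * s ^ 2 ≤ D.card * s := by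
    calc 2 * s ^ 2 = ∑ z ∈ {x, y}, (reproKernel n I).eval (ip x z) ^ 2 := by
          rw [Finset.sum_pair hne, kernel_one, kernel_antipode, mul_pow, ← pow_mul, mul_comm k,
            (even_two_mul k).neg_one_pow]
          ring
      _ ≤ ∑ z ∈ D, (reproKernel n I).eval (ip x z) ^ 2 :=
          Finset.sum_le_sum_of_subset_of_nonneg
            (Finset.insert_subset hx (Finset.singleton_subset_iff.2 hy)) fun _ _ _ => sq_nonneg _
      _ = D.card * s := by
          rw [hs, ← hD.sum_sq_reproKernel (I := I) (fun i hi => by have := (hI i hi).1; lia) x]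
  have two_mul_le : 2 * s ≤ D.card := by
    rcases (show 0 ≤ s from Finset.sum_nonneg fun _ _ => Nat.cast_nonneg _).eq_or_lt with h | h
    · rw [← h, mul_zero]
      exact Nat.cast_nonneg _
    · exact le_of_mul_le_mul_right (by linarith [two_mul_sq_le]) h
  rw [hs] at two_mul_le
  exact_mod_cast two_mul_le

theorem rao_le_card_of_antipodal (hD : IsDesign (2 * k) D) {x y : Cube n} (hx : x ∈ D) (hy : y ∈ D)
    (hxy : ip x y = -1) : rao n (2 * k + 1) ≤ D.card := by
  obtain ⟨m, rfl⟩ : ∃ m, n = m + 1 := by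
    refine Nat.exists_eq_add_one.2 (Nat.pos_of_ne_zero ?_)
    rintro rfl
    norm_num [Subsingleton.elim x y, ip_self] at hxy
  rw [rao_two_mul_add_one, Nat.add_sub_cancel, ← sum_choose_same_parity]
  refine hD.two_mul_sum_choose_le_card_of_antipodal hx hy hxy fun i hi => ?_
  rwa [Finset.mem_filter, Finset.mem_range, Nat.lt_succ_iff] at hi

end IsDesign

/-! ### Orthogonal polynomials of a positive functional -/

section Roots

lemma exists_mem_eval_ne_zero {R : Type*} [CommRing R] [IsDomain R] {p : R[X]} {T : Set R}
    (hp : p ≠ 0) (hT : (p.natDegree : ℕ∞) < T.encard) : ∃ t ∈ T, p.eval t ≠ 0 := by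
  classical
  by_contra! h
  have hsub : T ⊆ p.roots.toFinset := fun t ht => by
    rw [Finset.mem_coe, Multiset.mem_toFinset, mem_roots hp]
    exact h t ht
  have hcard : T.encard ≤ p.natDegree :=
    calc T.encard ≤ (p.roots.toFinset : Set R).encard := Set.encard_le_encard hsub
      _ = p.roots.toFinset.card := Set.encard_coe_eq_coe_finsetCard _
      _ ≤ p.natDegree := by
        exact_mod_cast (Multiset.toFinset_card_le _).trans (card_roots' p)
  exact hT.not_ge hcard

variable {R : Type*} [CommRing R] [IsDomain R] [LinearOrder R] {k : ℕ}

lemma exists_strictMono_eq_nodal {p : R[X]} (hp : p.Monic) (hsplit : p.Splits)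
    (hnodup : p.roots.Nodup) (hk : p.natDegree = k) :
    ∃ b : Fin k → R, StrictMono b ∧ p = Lagrange.nodal Finset.univ b := by
  have hcard : p.roots.toFinset.card = k := by
    rw [Multiset.toFinset_card_of_nodup hnodup, ← hsplit.natDegree_eq_card_roots, hk]
  set b := p.roots.toFinset.orderEmbOfFin hcard
  refine ⟨b, b.strictMono, ?_⟩
  calc p = (p.roots.map fun r => X - C r).prod := hsplit.eq_prod_roots_of_monic hp
    _ = ∏ r ∈ p.roots.toFinset, (X - C r) := by
        rw [Finset.prod, Multiset.toFinset_val, hnodup.dedup]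
    _ = ∏ r ∈ Finset.univ.image b, (X - C r) := by rw [Finset.image_orderEmbOfFin_univ]
    _ = Lagrange.nodal Finset.univ b := Finset.prod_image b.injective.injOn

lemma nodal_inj_of_strictMono {b b' : Fin k → R} (hb : StrictMono b) (hb' : StrictMono b') :
    Lagrange.nodal Finset.univ b = Lagrange.nodal Finset.univ b' ↔ b = b' := by
  refine ⟨fun h => ?_, fun h => h ▸ rfl⟩
  have isRoot_iff (c : Fin k → R) (r : R) :
      (Lagrange.nodal Finset.univ c).IsRoot r ↔ r ∈ Set.range c := by
    simp [IsRoot, Lagrange.eval_nodal, Finset.prod_eq_zero_iff, sub_eq_zero, @eq_comm _ r]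
  rw [← StrictMono.range_inj hb hb']
  ext r
  rw [← isRoot_iff, ← isRoot_iff, h]

end Roots

lemma apply_eq_sum_of_orthogonal_nodal {F ι : Type*} [Field F] [DecidableEq ι] {s : Finset ι}
    {v : ι → F} (hv : Set.InjOn v s) {L : F[X] →ₗ[F] F} {m : ℕ}
    (hL : ∀ r : F[X], r.degree < m → L (Lagrange.nodal s v * r) = 0) {f : F[X]}
    (hf : f.degree < s.card + m) :
    L f = ∑ i ∈ s, L (Lagrange.basis s v i) * f.eval (v i) := by
  have hmonic : (Lagrange.nodal s v).Monic := Lagrange.nodal_monic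
  set q := f /ₘ Lagrange.nodal s v
  set r := f %ₘ Lagrange.nodal s v
  have hfqr : f = r + Lagrange.nodal s v * q := (modByMonic_add_div f _).symm
  have hr : r.degree < s.card := by
    simpa only [Lagrange.degree_nodal] using degree_modByMonic_lt f hmonic
  have hq : q.degree < m := by
    by_cases hlt : f.degree < (Lagrange.nodal s v).degree
    · rw [show q = 0 from (divByMonic_eq_zero_iff hmonic).2 hlt, degree_zero]
      exact WithBot.bot_lt_coe m
    · have hadd : s.card + q.degree = f.degree := by
        simpa only [Lagrange.degree_nodal] using degree_add_divByMonic hmonic (not_lt.1 hlt)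
      exact lt_of_add_lt_add_left (hadd.trans_lt hf)
  have heval : ∀ i ∈ s, r.eval (v i) = f.eval (v i) := fun i hi => by
    rw [hfqr, eval_add, eval_mul, Lagrange.eval_nodal_at_node hi, zero_mul, add_zero]
  calc L f = L r := by rw [hfqr, map_add, hL q hq, add_zero]
    _ = L (Lagrange.interpolate s v fun i => f.eval (v i)) := by
        rw [← Lagrange.eq_interpolate_of_eval_eq _ hv hr heval]
    _ = ∑ i ∈ s, L (Lagrange.basis s v i) * f.eval (v i) := by
        rw [Lagrange.interpolate_apply, map_sum]
        refine Finset.sum_congr rfl fun i _ => ?_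
        rw [← smul_eq_C_mul, map_smul, smul_eq_mul, mul_comm]

/-- The functional `L` is positive on every polynomial that is nonnegative but does not vanish
identically on `T`, as is integration against a measure with support `T`. -/
def IsStrictlyPositiveOn (L : ℝ[X] →ₗ[ℝ] ℝ) (T : Set ℝ) : Prop :=
  ∀ p : ℝ[X], (∀ t ∈ T, 0 ≤ p.eval t) → (∃ t ∈ T, p.eval t ≠ 0) → 0 < L p

/-- `p` is the monic orthogonal polynomial of degree `k` for the bilinear form
`(p, r) ↦ L (p * r)`. -/
structure IsMonicOrthogonal (L : ℝ[X] →ₗ[ℝ] ℝ) (k : ℕ) (p : ℝ[X]) : Prop where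
  monic : p.Monic
  natDegree_eq : p.natDegree = k
  orthogonal : ∀ r : ℝ[X], r.degree < k → L (p * r) = 0

section OrthogonalPolynomial

variable {L : ℝ[X] →ₗ[ℝ] ℝ} {T : Set ℝ} {k : ℕ}

namespace IsStrictlyPositiveOn

lemma apply_mul_sq_pos (hL : IsStrictlyPositiveOn L T) {g u : ℝ[X]} (hg : ∀ t ∈ T, 0 < g.eval t)
    (hu : u ≠ 0) (huT : (u.natDegree : ℕ∞) < T.encard) : 0 < L (g * u ^ 2) := by
  obtain ⟨t, ht, hut⟩ := exists_mem_eval_ne_zero hu huT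
  refine hL _ (fun s hs => ?_) ⟨t, ht, ?_⟩ <;> rw [eval_mul, eval_pow]
  · exact mul_nonneg (hg s hs).le (sq_nonneg _)
  · exact (mul_pos (hg t ht) (sq_pos_of_ne_zero hut)).ne'

lemma apply_sq_pos (hL : IsStrictlyPositiveOn L T) {u : ℝ[X]} (hu : u ≠ 0)
    (huT : (u.natDegree : ℕ∞) < T.encard) : 0 < L (u ^ 2) := by
  simpa only [one_mul] using hL.apply_mul_sq_pos (g := 1) (fun _ _ => by simp) hu huT

lemma comp_mulLeft_X_sub_C (hL : IsStrictlyPositiveOn L T) {a : ℝ} (hT : ∀ t ∈ T, a ≤ t) :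
    IsStrictlyPositiveOn (L ∘ₗ LinearMap.mulLeft ℝ (X - C a)) (T \ {a}) := by
  rintro p hp ⟨t, ⟨ht, hta⟩, hpt⟩
  refine hL _ (fun s hs => ?_) ⟨t, ht, ?_⟩ <;>
    simp only [LinearMap.mulLeft_apply, eval_mul, eval_sub, eval_X, eval_C]
  · rcases eq_or_ne s a with rfl | hsa
    · rw [sub_self, zero_mul]
    · exact mul_nonneg (sub_nonneg.2 (hT s hs)) (hp s ⟨hs, hsa⟩)
  · exact mul_ne_zero (sub_ne_zero.2 hta) hpt

lemma eq_zero_of_apply_mul_self_eq_zero (hL : IsStrictlyPositiveOn L T) (hT : k ≤ T.encard)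
    {u : ℝ[X]} (hu : u.degree < k) (h0 : L (u * u) = 0) : u = 0 := by
  by_contra hne
  have hdeg : (u.natDegree : ℕ∞) < T.encard :=
    lt_of_lt_of_le (by exact_mod_cast (natDegree_lt_iff_degree_lt hne).2 hu) hT
  have hpos := hL.apply_sq_pos hne hdeg
  rw [sq, h0] at hpos
  exact hpos.false

theorem exists_isMonicOrthogonal (hL : IsStrictlyPositiveOn L T) (hT : k ≤ T.encard) :
    ∃ p, IsMonicOrthogonal L k p := by
  let Φ : degreeLT ℝ k →ₗ[ℝ] Module.Dual ℝ (degreeLT ℝ k) :=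
    ((LinearMap.mul ℝ ℝ[X]).compr₂ L).domRestrict₁₂ (degreeLT ℝ k) (degreeLT ℝ k)
  have Φ_injective : Function.Injective Φ := by
    refine (injective_iff_map_eq_zero Φ).2 fun q hq => Subtype.ext ?_
    exact hL.eq_zero_of_apply_mul_self_eq_zero hT (mem_degreeLT.1 q.2) (LinearMap.congr_fun hq q)
  obtain ⟨⟨q, hq⟩, hΦ⟩ := (LinearMap.injective_iff_surjective_of_finrank_eq_finrank
    (Subspace.dual_finrank_eq (K := ℝ) (V := degreeLT ℝ k)).symm).1 Φ_injective
    ((L ∘ₗ LinearMap.mulLeft ℝ (X ^ k)).domRestrict (degreeLT ℝ k))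
  have hqd : q.degree < (X ^ k : ℝ[X]).degree := by
    rw [degree_X_pow]
    exact mem_degreeLT.1 hq
  refine ⟨X ^ k - q, ⟨(monic_X_pow k).sub_of_left hqd, ?_, fun r hr => ?_⟩⟩
  · rw [natDegree_eq_of_degree_eq (degree_sub_eq_left_of_degree_lt hqd), natDegree_X_pow]
  · have h : L (q * r) = L (X ^ k * r) := LinearMap.congr_fun hΦ ⟨r, mem_degreeLT.2 hr⟩
    rw [sub_mul, map_sub, h, sub_self]

end IsStrictlyPositiveOn

namespace IsMonicOrthogonal

variable {p : ℝ[X]}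

lemma eq_of_isStrictlyPositiveOn {q : ℝ[X]} (hp : IsMonicOrthogonal L k p)
    (hq : IsMonicOrthogonal L k q) (hL : IsStrictlyPositiveOn L T) (hT : k ≤ T.encard) :
    p = q := by
  have hdeg : (p - q).degree < k := by
    have h := degree_sub_lt_left (p := p) (q := q)
      (by rw [degree_eq_natDegree hp.monic.ne_zero, degree_eq_natDegree hq.monic.ne_zero,
        hp.natDegree_eq, hq.natDegree_eq])
      hp.monic.ne_zero (by rw [hp.monic.leadingCoeff, hq.monic.leadingCoeff])
    rwa [degree_eq_natDegree hp.monic.ne_zero, hp.natDegree_eq] at h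
  refine sub_eq_zero.1 (hL.eq_zero_of_apply_mul_self_eq_zero hT hdeg ?_)
  rw [sub_mul, map_sub, hp.orthogonal _ hdeg, hq.orthogonal _ hdeg, sub_self]

lemma mul_ne_mul_sq (hp : IsMonicOrthogonal L k p) (hL : IsStrictlyPositiveOn L T)
    (hT : k ≤ T.encard) {g s u : ℝ[X]} (hg : ∀ t ∈ T, 0 < g.eval t) (hs : s.degree < k)
    (hu : u ≠ 0) (huk : u.degree < k) : p * s ≠ g * u ^ 2 := by
  intro h
  have hdeg : (u.natDegree : ℕ∞) < T.encard :=
    lt_of_lt_of_le (by exact_mod_cast (natDegree_lt_iff_degree_lt hu).2 huk) hT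
  have hpos := hL.apply_mul_sq_pos hg hu hdeg
  rw [← h, hp.orthogonal s hs] at hpos
  exact hpos.false

lemma ne_zero_and_degree_lt_of_eq_mul (hp : IsMonicOrthogonal L k p) {g q : ℝ[X]} (h : p = g * q)
    (hg : 0 < g.natDegree) : q ≠ 0 ∧ q.degree < k := by
  have hgq : g * q ≠ 0 := h ▸ hp.monic.ne_zero
  have hq : q ≠ 0 := right_ne_zero_of_mul hgq
  have hdeg := natDegree_mul (left_ne_zero_of_mul hgq) hq
  rw [← h, hp.natDegree_eq] at hdeg
  exact ⟨hq, (natDegree_lt_iff_degree_lt hq).1 (by lia)⟩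

lemma ne_mul_of_pos (hp : IsMonicOrthogonal L k p) (hL : IsStrictlyPositiveOn L T)
    (hT : k ≤ T.encard) {g q : ℝ[X]} (hg : ∀ t ∈ T, 0 < g.eval t) (hg0 : 0 < g.natDegree) :
    p ≠ g * q := by
  intro h
  obtain ⟨hq, hqk⟩ := hp.ne_zero_and_degree_lt_of_eq_mul h hg0
  exact hp.mul_ne_mul_sq hL hT hg hqk hq hqk (by rw [h]; ring)

lemma root_mem_Ioo (hp : IsMonicOrthogonal L k p) (hL : IsStrictlyPositiveOn L T)
    (hT : k ≤ T.encard) {a b : ℝ} (hab : T ⊆ Set.Ioo a b) {r : ℝ} (hr : p.IsRoot r) :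
    r ∈ Set.Ioo a b := by
  obtain ⟨q, hq⟩ := dvd_iff_isRoot.2 hr
  constructor
  · by_contra! hra
    refine hp.ne_mul_of_pos hL hT (fun t ht => ?_) (by rw [natDegree_X_sub_C]; exact one_pos) hq
    simpa using hra.trans_lt (hab ht).1
  · by_contra! hbr
    refine hp.ne_mul_of_pos hL hT (g := C r - X) (q := -q) (fun t ht => ?_)
      (by rw [natDegree_C_sub_X]; exact one_pos) (by rw [hq]; ring)
    simpa using (hab ht).2.trans_le hbr

lemma splits (hp : IsMonicOrthogonal L k p) (hL : IsStrictlyPositiveOn L T)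
    (hT : k ≤ T.encard) : p.Splits := by
  refine Splits.of_splits_map (algebraMap ℝ ℂ) (IsAlgClosed.splits _) fun z hz => ?_
  have hz0 : aeval z p = 0 := by
    rw [mem_roots', IsRoot, eval_map_algebraMap] at hz
    exact hz.2
  by_cases him : z.im = 0
  · exact ⟨z.re, Complex.ext rfl him.symm⟩
  obtain ⟨q, hq⟩ := quadratic_dvd_of_aeval_eq_zero_im_ne_zero p hz0 him
  refine absurd hq (hp.ne_mul_of_pos hL hT (fun t _ => ?_) ?_)
  · have hnorm : ‖z‖ ^ 2 = z.re ^ 2 + z.im ^ 2 := by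
      rw [Complex.sq_norm, Complex.normSq_apply, sq, sq]
    have him_pos : 0 < z.im ^ 2 := sq_pos_of_ne_zero him
    simp only [eval_add, eval_sub, eval_pow, eval_mul, eval_X, eval_C, hnorm]
    nlinarith [sq_nonneg (t - z.re)]
  · have hquad : X ^ 2 - C (2 * z.re) * X + C (‖z‖ ^ 2) =
        (C 1 * X ^ 2 + C (-(2 * z.re)) * X + C (‖z‖ ^ 2) : ℝ[X]) := by
      rw [C_1, C_neg]
      ring
    rw [hquad, natDegree_quadratic one_ne_zero]
    exact two_pos

lemma nodup_roots (hp : IsMonicOrthogonal L k p) (hL : IsStrictlyPositiveOn L T)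
    (hT : k ≤ T.encard) : p.roots.Nodup := by
  classical
  refine Multiset.nodup_iff_count_le_one.2 fun r => ?_
  rw [count_roots]
  by_contra! hmult
  obtain ⟨q, hq⟩ := (le_rootMultiplicity_iff hp.monic.ne_zero).1 hmult
  have hdeg : 0 < ((X - C r : ℝ[X]) ^ 2).natDegree := by simp
  have hfactor : p = (X - C r) * ((X - C r) * q) := by rw [hq]; ring
  obtain ⟨-, hqk⟩ := hp.ne_zero_and_degree_lt_of_eq_mul hq hdeg
  obtain ⟨hu, huk⟩ := hp.ne_zero_and_degree_lt_of_eq_mul hfactor (by simp)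
  exact hp.mul_ne_mul_sq hL hT (g := 1) (fun _ _ => by simp) hqk hu huk (by rw [hq]; ring)

theorem exists_strictMono_eq_nodal (hp : IsMonicOrthogonal L k p) (hL : IsStrictlyPositiveOn L T)
    (hT : k ≤ T.encard) {a b : ℝ} (hab : T ⊆ Set.Ioo a b) :
    ∃ z : Fin k → ℝ, StrictMono z ∧ (∀ i, z i ∈ Set.Ioo a b) ∧
      p = Lagrange.nodal Finset.univ z := by
  obtain ⟨z, hz, hpz⟩ := HammingEnergy.exists_strictMono_eq_nodal hp.monic (hp.splits hL hT)
    (hp.nodup_roots hL hT) hp.natDegree_eq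
  refine ⟨z, hz, fun i => hp.root_mem_Ioo hL hT hab ?_, hpz⟩
  rw [hpz]
  exact Lagrange.eval_nodal_at_node (Finset.mem_univ i)

end IsMonicOrthogonal

end OrthogonalPolynomial

/-! ### Gauss–Radau quadrature -/

/-- The Gauss–Radau rule of `L` with the prescribed node `a` and `k` free nodes in `(a, b)`, exact
in degree at most `2k`. -/
structure IsRadauRule (L : ℝ[X] →ₗ[ℝ] ℝ) (a b : ℝ) (k : ℕ) (β γ : Fin (k + 1) → ℝ) : Prop where
  zero_node : β 0 = a
  strictMono : StrictMono β
  lt : ∀ i, β i < b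
  weight_pos : ∀ i, 0 < γ i
  exact : ∀ f : ℝ[X], f.natDegree ≤ 2 * k → L f = ∑ i, γ i * f.eval (β i)

section Radau

variable {L : ℝ[X] →ₗ[ℝ] ℝ} {T : Set ℝ} {a b : ℝ} {k : ℕ} {β γ : Fin (k + 1) → ℝ}

lemma nodal_univ_succ {R : Type*} [CommRing R] (v : Fin (k + 1) → R) :
    Lagrange.nodal Finset.univ v =
      (X - C (v 0)) * Lagrange.nodal Finset.univ fun i : Fin k => v i.succ := by
  simp only [Lagrange.nodal, Fin.prod_univ_succ]

lemma sum_mul_eval_basis_pow {ι F : Type*} [Field F] [Fintype ι] [DecidableEq ι] {v : ι → F}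
    (hv : Function.Injective v) (w : ι → F) {m : ℕ} (hm : m ≠ 0) (i : ι) :
    ∑ j, w j * (Lagrange.basis Finset.univ v i ^ m).eval (v j) = w i := by
  rw [Finset.sum_eq_single_of_mem i (Finset.mem_univ i) fun j _ hji => ?_]
  · rw [eval_pow, Lagrange.eval_basis_self hv.injOn (Finset.mem_univ i), one_pow, mul_one]
  · rw [eval_pow, Lagrange.eval_basis_of_ne hji.symm (Finset.mem_univ j), zero_pow hm, mul_zero]

lemma natDegree_basis_univ {F : Type*} [Field F] {v : Fin (k + 1) → F}
    (hv : Function.Injective v) (i : Fin (k + 1)) :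
    (Lagrange.basis Finset.univ v i).natDegree = k := by
  rw [Lagrange.natDegree_basis hv.injOn (Finset.mem_univ i), Finset.card_univ, Fintype.card_fin,
    Nat.add_sub_cancel]

lemma le_encard_sdiff_singleton (a : ℝ) (hT : k < T.encard) : k ≤ (T \ {a}).encard :=
  (ENat.le_sub_one_of_lt hT).trans (Set.encard_tsub_one_le_encard_sdiff_singleton T a)

lemma IsStrictlyPositiveOn.isRadauRule_of_exact (hL : IsStrictlyPositiveOn L T)
    (hT : k < T.encard) (h0 : β 0 = a) (hβ : StrictMono β) (hb : ∀ i, β i < b)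
    (hexact : ∀ f : ℝ[X], f.natDegree ≤ 2 * k → L f = ∑ i, γ i * f.eval (β i)) :
    IsRadauRule L a b k β γ := by
  refine ⟨h0, hβ, hb, fun i => ?_, hexact⟩
  have hdeg := natDegree_basis_univ hβ.injective i
  calc 0 < L (Lagrange.basis Finset.univ β i ^ 2) :=
        hL.apply_sq_pos (Lagrange.basis_ne_zero hβ.injective.injOn (Finset.mem_univ i))
          (by rwa [hdeg])
    _ = γ i := by
        rw [hexact _ (by rw [natDegree_pow, hdeg]),
          sum_mul_eval_basis_pow hβ.injective γ two_ne_zero]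

theorem IsStrictlyPositiveOn.exists_isRadauRule (hL : IsStrictlyPositiveOn L T)
    (hab : T ⊆ Set.Ico a b) (hT : k < T.encard) : ∃ β γ, IsRadauRule L a b k β γ := by
  have hL' := hL.comp_mulLeft_X_sub_C fun t ht => (hab ht).1
  have hT' := le_encard_sdiff_singleton a hT
  have hab' : T \ {a} ⊆ Set.Ioo a b := fun t ht =>
    ⟨lt_of_le_of_ne (hab ht.1).1 (Ne.symm ht.2), (hab ht.1).2⟩
  have hlt : a < b := by
    obtain ⟨t, ht⟩ := Set.encard_pos.1 (pos_of_gt hT)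
    exact (hab ht).1.trans_lt (hab ht).2
  obtain ⟨p, hp⟩ := hL'.exists_isMonicOrthogonal hT'
  obtain ⟨z, hz, hzab, rfl⟩ := hp.exists_strictMono_eq_nodal hL' hT' hab'
  set β : Fin (k + 1) → ℝ := Fin.cons a z
  have hβ : StrictMono β := Fin.strictMono_cons.2 ⟨fun i => (hzab i).1, hz⟩
  have horth (r : ℝ[X]) (hr : r.degree < k) : L (Lagrange.nodal Finset.univ β * r) = 0 := by
    rw [nodal_univ_succ, mul_assoc]
    exact hp.orthogonal r hr
  refine ⟨β, _, hL.isRadauRule_of_exact hT rfl hβ (Fin.cases hlt fun i => (hzab i).2)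
    fun f hf => apply_eq_sum_of_orthogonal_nodal hβ.injective.injOn horth ?_⟩
  rw [Finset.card_univ, Fintype.card_fin]
  exact degree_le_natDegree.trans_lt (by exact_mod_cast (by lia : f.natDegree < k + 1 + k))

namespace IsRadauRule

lemma isMonicOrthogonal (h : IsRadauRule L a b k β γ) :
    IsMonicOrthogonal (L ∘ₗ LinearMap.mulLeft ℝ (X - C a)) k
      (Lagrange.nodal Finset.univ fun i : Fin k => β i.succ) := by
  refine ⟨Lagrange.nodal_monic, by simp, fun r hr => ?_⟩
  rw [LinearMap.comp_apply, LinearMap.mulLeft_apply, ← mul_assoc, ← h.zero_node,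
    ← nodal_univ_succ]
  rcases eq_or_ne r 0 with rfl | hr0
  · rw [mul_zero, map_zero]
  have hdeg : (Lagrange.nodal Finset.univ β * r).natDegree ≤ 2 * k := by
    have hrk := (natDegree_lt_iff_degree_lt hr0).2 hr
    grw [natDegree_mul_le, Lagrange.natDegree_nodal, Finset.card_univ, Fintype.card_fin]
    lia
  rw [h.exact _ hdeg]
  refine Finset.sum_eq_zero fun i hi => ?_
  rw [eval_mul, Lagrange.eval_nodal_at_node hi, zero_mul, mul_zero]

lemma weight_eq (h : IsRadauRule L a b k β γ) (i : Fin (k + 1)) :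
    γ i = L (Lagrange.basis Finset.univ β i) := by
  have hβ := h.strictMono.injective
  rw [h.exact _ (by rw [natDegree_basis_univ hβ]; lia)]
  simpa only [pow_one] using (sum_mul_eval_basis_pow hβ γ one_ne_zero i).symm

theorem eq_of_isStrictlyPositiveOn {β' γ' : Fin (k + 1) → ℝ} (h : IsRadauRule L a b k β γ)
    (h' : IsRadauRule L a b k β' γ') (hL : IsStrictlyPositiveOn L T) (haT : ∀ t ∈ T, a ≤ t)
    (hT : k < T.encard) : β = β' ∧ γ = γ' := by
  have hnodal := h.isMonicOrthogonal.eq_of_isStrictlyPositiveOn h'.isMonicOrthogonal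
    (hL.comp_mulLeft_X_sub_C haT) (le_encard_sdiff_singleton a hT)
  have htail := (nodal_inj_of_strictMono (h.strictMono.comp Fin.strictMono_succ)
    (h'.strictMono.comp Fin.strictMono_succ)).1 hnodal
  obtain rfl : β = β' :=
    funext <| Fin.cases (h.zero_node.trans h'.zero_node.symm) fun i => congrFun htail i
  exact ⟨rfl, funext fun i => (h.weight_eq i).trans (h'.weight_eq i).symm⟩

lemma exists_mem_lt_node (h : IsRadauRule L a b k β γ) (hL : IsStrictlyPositiveOn L T)
    (hT : k < T.encard) (i : Fin k) : ∃ t ∈ T, t < β i.succ := by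
  by_contra! hle
  set u : ℝ[X] := ∏ j ∈ Finset.univ.erase i, (X - C (β j.succ))
  have huk : u.natDegree = k - 1 := by
    rw [natDegree_prod_of_monic _ _ fun j _ => monic_X_sub_C _]
    simp
  have hdeg : ((X - C (β i.succ)) * u ^ 2).natDegree ≤ 2 * k := by
    grw [natDegree_mul_le, natDegree_X_sub_C, natDegree_pow, huk]
    have hk := i.pos
    lia
  have hnodal : (X - C (β i.succ)) * u = Lagrange.nodal Finset.univ fun j : Fin k => β j.succ :=
    Finset.mul_prod_erase _ (fun j : Fin k => X - C (β j.succ)) (Finset.mem_univ i)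
  have hpos : 0 < L ((X - C (β i.succ)) * u ^ 2) := by
    obtain ⟨t, ht, hne⟩ := exists_mem_eval_ne_zero (T := T)
      (h.isMonicOrthogonal.monic.ne_zero) (by rwa [h.isMonicOrthogonal.natDegree_eq])
    rw [← hnodal, eval_mul] at hne
    refine hL _ (fun s hs => ?_) ⟨t, ht, ?_⟩ <;> rw [eval_mul, eval_pow]
    · exact mul_nonneg (by simpa using hle s hs) (sq_nonneg _)
    · exact mul_ne_zero (left_ne_zero_of_mul hne) (pow_ne_zero 2 (right_ne_zero_of_mul hne))
  have heval_tail (j : Fin k) : ((X - C (β i.succ)) * u ^ 2).eval (β j.succ) = 0 := by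
    rw [sq, ← mul_assoc, hnodal, eval_mul,
      Lagrange.eval_nodal_at_node (v := fun j : Fin k => β j.succ) (Finset.mem_univ j), zero_mul]
  have heval_zero : ((X - C (β i.succ)) * u ^ 2).eval (β 0) ≤ 0 := by
    rw [eval_mul, eval_pow, eval_sub, eval_X, eval_C]
    exact mul_nonpos_of_nonpos_of_nonneg
      (sub_nonpos.2 (h.strictMono.monotone (Fin.zero_le _))) (sq_nonneg _)
  rw [h.exact _ hdeg, Fin.sum_univ_succ] at hpos
  simp only [heval_tail, mul_zero, Finset.sum_const_zero, add_zero] at hpos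
  exact hpos.not_ge (mul_nonpos_of_nonneg_of_nonpos (h.weight_pos 0).le heval_zero)

end IsRadauRule

end Radau

/-! ### Hermite interpolation -/

section Rolle

variable {f : ℝ → ℝ} {s : Set ℝ} {Z D : Finset ℝ} {n : ℕ}

lemma exists_finset_deriv_eq_zero (hs : s.OrdConnected) (hf : ContinuousOn f s) (hZ : ↑Z ⊆ s)
    (h0 : ∀ z ∈ Z, f z = 0) :
    ∃ W : Finset ℝ, Z.card ≤ W.card + 1 ∧ Disjoint W Z ∧ ↑W ⊆ interior s ∧
      ∀ w ∈ W, deriv f w = 0 := by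
  rcases hm : Z.card with _ | m
  · exact ⟨∅, by simp⟩
  set z := Z.orderEmbOfFin hm
  have hzZ (i : Fin (m + 1)) : z i ∈ Z := Z.orderEmbOfFin_mem hm i
  have rolle (i : Fin m) : ∃ c ∈ Set.Ioo (z i.castSucc) (z i.succ), deriv f c = 0 :=
    exists_deriv_eq_zero (z.strictMono i.castSucc_lt_succ)
      (hf.mono (hs.out (hZ (hzZ _)) (hZ (hzZ _)))) (by rw [h0 _ (hzZ _), h0 _ (hzZ _)])
  choose w hw hw0 using rolle
  have hwmono : StrictMono w := fun i j hij =>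
    (hw i).2.trans_le ((z.monotone (Fin.succ_le_castSucc_iff.2 hij)).trans (hw j).1.le)
  refine ⟨Finset.univ.image w, ?_, Finset.disjoint_left.2 ?_, ?_, ?_⟩
  · rw [Finset.card_image_of_injective _ hwmono.injective, Finset.card_univ, Fintype.card_fin]
  · simp only [Finset.mem_image, Finset.mem_univ, true_and, forall_exists_index,
      forall_apply_eq_imp_iff]
    intro i hi
    obtain ⟨j, hj⟩ : w i ∈ Set.range z := by rwa [Finset.range_orderEmbOfFin]
    obtain ⟨hlt, hgt⟩ := hw i
    rw [← hj, z.lt_iff_lt] at hlt hgt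
    exact hlt.not_ge (Fin.le_castSucc_iff.2 hgt)
  · rw [Finset.coe_image, Finset.coe_univ, Set.image_univ, Set.range_subset_iff]
    exact fun i => interior_maximal
      (Set.Ioo_subset_Icc_self.trans (hs.out (hZ (hzZ _)) (hZ (hzZ _)))) isOpen_Ioo (hw i)
  · simpa only [Finset.mem_image, Finset.mem_univ, true_and, forall_exists_index,
      forall_apply_eq_imp_iff] using hw0

theorem exists_iteratedDeriv_eq_zero (hs : s.OrdConnected) (hso : IsOpen s)
    (hf : ContDiffOn ℝ n f s) (hZ : ↑Z ⊆ s) (h0 : ∀ z ∈ Z, f z = 0) (hn : n < Z.card) :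
    ∃ ξ ∈ s, iteratedDeriv n f ξ = 0 := by
  induction n generalizing f Z with
  | zero =>
    obtain ⟨z, hz⟩ := Finset.card_pos.1 hn
    exact ⟨z, hZ hz, by rw [iteratedDeriv_zero, h0 z hz]⟩
  | succ n ih =>
    obtain ⟨W, hcard, -, hWs, hW0⟩ := exists_finset_deriv_eq_zero hs hf.continuousOn hZ h0
    rw [iteratedDeriv_succ']
    exact ih (hf.deriv_of_isOpen hso (by push_cast; rfl)) (hWs.trans interior_subset) hW0 (by lia)

theorem exists_iteratedDeriv_eq_zero_of_double_zeros (hs : s.OrdConnected)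
    (hc : ContinuousOn f s) (hf : ContDiffOn ℝ (n + 1 : ℕ) f (interior s)) (hZ : ↑Z ⊆ s)
    (h0 : ∀ z ∈ Z, f z = 0) (hDZ : D ⊆ Z) (hD : ↑D ⊆ interior s) (hD0 : ∀ z ∈ D, deriv f z = 0)
    (hn : n + 1 < Z.card + D.card) : ∃ ξ ∈ interior s, iteratedDeriv (n + 1) f ξ = 0 := by
  obtain ⟨W, hcard, hdisj, hWs, hW0⟩ := exists_finset_deriv_eq_zero hs hc hZ h0
  have hWD : (W ∪ D).card = W.card + D.card :=
    Finset.card_union_of_disjoint (hdisj.mono_right hDZ)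
  rw [iteratedDeriv_succ']
  refine exists_iteratedDeriv_eq_zero (Z := W ∪ D) hs.interior isOpen_interior
    (hf.deriv_of_isOpen isOpen_interior (by push_cast; rfl)) ?_ (fun z hz => ?_) (by lia)
  · rw [Finset.coe_union]
    exact Set.union_subset hWs hD
  · exact (Finset.mem_union.1 hz).elim (hW0 z) (hD0 z)

lemma iteratedDeriv_eval_of_natDegree_le {p : ℝ[X]} (hp : p.natDegree ≤ n) (x : ℝ) :
    iteratedDeriv n (fun t => p.eval t) x = n.factorial * p.coeff n := by
  have iteratedDeriv_eval (m : ℕ) (q : ℝ[X]) :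
      iteratedDeriv m (fun t => q.eval t) = fun t => (derivative^[m] q).eval t := by
    induction m generalizing q with
    | zero => rfl
    | succ m ih =>
      have hq : deriv (fun t => q.eval t) = fun t => (derivative q).eval t :=
        funext fun t => q.deriv
      rw [iteratedDeriv_succ', hq, ih, Function.iterate_succ_apply]
  have hconst : (derivative^[n] p).natDegree ≤ 0 :=
    (natDegree_iterate_derivative p n).trans (by lia)
  calc iteratedDeriv n (fun t => p.eval t) x = (derivative^[n] p).eval x :=
        congrFun (iteratedDeriv_eval n p) x
    _ = n.factorial * p.coeff n := by
        rw [eq_C_of_natDegree_le_zero hconst, eval_C, coeff_iterate_derivative, zero_add,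
          Nat.descFactorial_self, nsmul_eq_mul]

theorem exists_iteratedDeriv_eq_factorial_mul_coeff {h : ℝ → ℝ} (hs : s.OrdConnected)
    (hc : ContinuousOn h s) (hd : ContDiffOn ℝ (n + 1 : ℕ) h (interior s)) (hZ : ↑Z ⊆ s)
    (hDZ : D ⊆ Z) (hD : ↑D ⊆ interior s) (hn : n + 1 < Z.card + D.card) {P : ℝ[X]}
    (hP : P.natDegree ≤ n + 1) (hPZ : ∀ z ∈ Z, P.eval z = h z)
    (hPD : ∀ z ∈ D, (derivative P).eval z = deriv h z) :
    ∃ ξ ∈ interior s, iteratedDeriv (n + 1) h ξ = (n + 1).factorial * P.coeff (n + 1) := by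
  have hdAt {t : ℝ} (ht : t ∈ interior s) : ContDiffAt ℝ (n + 1 : ℕ) h t :=
    hd.contDiffAt (isOpen_interior.mem_nhds ht)
  have hPd : ContDiff ℝ (n + 1 : ℕ) fun t => P.eval t := by
    simpa only [coe_aeval_eq_eval] using P.contDiff_aeval (𝕜 := ℝ) (n + 1 : ℕ)
  obtain ⟨ξ, hξ, hξ0⟩ := exists_iteratedDeriv_eq_zero_of_double_zeros (f := h - fun t => P.eval t)
    hs (hc.sub P.continuous.continuousOn) (hd.sub hPd.contDiffOn) hZ
    (fun z hz => by rw [Pi.sub_apply, hPZ z hz, sub_self]) hDZ hD (fun z hz => by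
      rw [deriv_sub ((hdAt (hD hz)).differentiableAt (by simp)) P.differentiableAt, P.deriv,
        hPD z hz, sub_self]) hn
  refine ⟨ξ, hξ, ?_⟩
  rwa [iteratedDeriv_sub (hdAt hξ) hPd.contDiffAt, iteratedDeriv_eval_of_natDegree_le hP,
    sub_eq_zero] at hξ0

end Rolle

section Hermite

/-- The node polynomial of Hermite interpolation with simple nodes `A` and double nodes `B`. -/
noncomputable def hermiteNodal {F : Type*} [Field F] (A B : Finset F) : F[X] :=
  Lagrange.nodal A id * Lagrange.nodal B id ^ 2

/-- `G` is the Hermite interpolation polynomial that takes the values of `u` at the nodes in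
`A ∪ B` and whose derivative takes the values of `u'` at the nodes in `B`. -/
structure IsHermiteInterpolant {F : Type*} [Field F] (A B : Finset F) (u u' : F → F) (G : F[X]) :
    Prop where
  degree_lt : G.degree < (A.card + 2 * B.card : ℕ)
  eval_simple : ∀ a ∈ A, G.eval a = u a
  eval_double : ∀ b ∈ B, G.eval b = u b
  derivative_double : ∀ b ∈ B, (derivative G).eval b = u' b

variable {F : Type*} [Field F] {A B : Finset F}

lemma hermiteNodal_monic (A B : Finset F) : (hermiteNodal A B).Monic :=
  Lagrange.nodal_monic.mul (Lagrange.nodal_monic.pow 2)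

lemma natDegree_hermiteNodal (A B : Finset F) :
    (hermiteNodal A B).natDegree = A.card + 2 * B.card := by
  rw [hermiteNodal, Lagrange.nodal_monic.natDegree_mul (Lagrange.nodal_monic.pow 2),
    Lagrange.nodal_monic.natDegree_pow, Lagrange.natDegree_nodal, Lagrange.natDegree_nodal]

lemma eval_hermiteNodal (A B : Finset F) (t : F) :
    (hermiteNodal A B).eval t = (∏ a ∈ A, (t - a)) * (∏ b ∈ B, (t - b)) ^ 2 := by
  simp only [hermiteNodal, eval_mul, eval_pow, Lagrange.eval_nodal, id]

lemma eval_hermiteNodal_eq_zero_iff {t : F} :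
    (hermiteNodal A B).eval t = 0 ↔ t ∈ A ∨ t ∈ B := by
  simp [eval_hermiteNodal, Finset.prod_eq_zero_iff, sub_eq_zero]

lemma X_sub_C_sq_dvd_iff {p : F[X]} {a : F} :
    (X - C a) ^ 2 ∣ p ↔ p.eval a = 0 ∧ (derivative p).eval a = 0 := by
  rcases eq_or_ne p 0 with rfl | hp
  · simp
  · rw [← le_rootMultiplicity_iff hp]
    exact one_lt_rootMultiplicity_iff_isRoot hp

lemma eval_derivative_hermiteNodal {b : F} (hb : b ∈ B) :
    (derivative (hermiteNodal A B)).eval b = 0 :=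
  (X_sub_C_sq_dvd_iff.1 <| (pow_dvd_pow_of_dvd (Lagrange.X_sub_C_dvd_nodal id hb) 2).mul_left _).2

lemma hermiteNodal_dvd (hAB : Disjoint A B) {p : F[X]} (hpA : ∀ a ∈ A, p.eval a = 0)
    (hpB : ∀ b ∈ B, p.eval b = 0) (hpB' : ∀ b ∈ B, (derivative p).eval b = 0) :
    hermiteNodal A B ∣ p := by
  have coprime {a b : F} (hne : a ≠ b) : IsCoprime (X - C a) (X - C b) :=
    isCoprime_X_sub_C_of_isUnit_sub (sub_ne_zero.2 hne).isUnit
  rw [hermiteNodal, Lagrange.nodal, Lagrange.nodal, ← Finset.prod_pow]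
  refine IsCoprime.mul_dvd ?_ ?_ ?_
  · exact IsCoprime.prod_left fun a ha => IsCoprime.prod_right fun b hb =>
      (coprime (hAB.forall_ne_finset ha hb)).pow_right
  · exact Finset.prod_dvd_of_coprime (fun a _ a' _ hne => coprime hne) fun a ha =>
      dvd_iff_isRoot.2 (hpA a ha)
  · exact Finset.prod_dvd_of_coprime (fun b _ b' _ hne => (coprime hne).pow) fun b hb =>
      X_sub_C_sq_dvd_iff.2 ⟨hpB b hb, hpB' b hb⟩

theorem existsUnique_isHermiteInterpolant (hAB : Disjoint A B) (u u' : F → F) :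
    ∃! G, IsHermiteInterpolant A B u u' G := by
  let evalAt (S : Finset F) : F[X] →ₗ[F] S → F := LinearMap.pi fun a => leval a.1
  let Φ : degreeLT F (A.card + 2 * B.card) →ₗ[F] (A → F) × (B → F) × (B → F) :=
    ((evalAt A).prod ((evalAt B).prod (evalAt B ∘ₗ derivative))) ∘ₗ (degreeLT F _).subtype
  have Φ_eq_iff (G : degreeLT F (A.card + 2 * B.card)) (v v' : F → F) :
      Φ G = (fun a : A => v a, fun b : B => v b, fun b : B => v' b) ↔
        IsHermiteInterpolant A B v v' G := by
    simp only [Φ, evalAt, LinearMap.comp_apply, LinearMap.prod_apply, Function.prod, Prod.mk.injEq,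
      funext_iff, LinearMap.pi_apply, leval_apply, Subtype.forall, Submodule.subtype_apply]
    exact ⟨fun ⟨h1, h2, h3⟩ => ⟨mem_degreeLT.1 G.2, h1, h2, h3⟩,
      fun ⟨_, h1, h2, h3⟩ => ⟨h1, h2, h3⟩⟩
  have Φ_injective : Function.Injective Φ := by
    refine (injective_iff_map_eq_zero Φ).2 fun G hG => Subtype.ext ?_
    obtain ⟨hdeg, hA, hB, hB'⟩ := (Φ_eq_iff G 0 0).1 hG
    refine eq_zero_of_dvd_of_degree_lt (hermiteNodal_dvd hAB hA hB hB') ?_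
    rwa [degree_eq_natDegree (hermiteNodal_monic A B).ne_zero, natDegree_hermiteNodal]
  have hdim : Module.finrank F (degreeLT F (A.card + 2 * B.card)) =
      Module.finrank F ((A → F) × (B → F) × (B → F)) := by
    rw [(degreeLTEquiv F _).finrank_eq]
    simp only [Module.finrank_prod, Module.finrank_fintype_fun_eq_card, Fintype.card_fin,
      Fintype.card_coe]
    ring
  obtain ⟨G, hG⟩ := (LinearMap.injective_iff_surjective_of_finrank_eq_finrank hdim).1 Φ_injective
    (fun a => u a, fun b => u b, fun b => u' b)
  refine ⟨G, (Φ_eq_iff G u u').1 hG, fun G' hG' => congrArg Subtype.val (Φ_injective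
    (a₁ := ⟨G', mem_degreeLT.2 hG'.degree_lt⟩) (((Φ_eq_iff _ u u').2 hG').trans hG.symm))⟩

namespace IsHermiteInterpolant

variable {u u' : F → F} {G : F[X]}

lemma eval_eq (hG : IsHermiteInterpolant A B u u' G) {t : F}
    (ht : (hermiteNodal A B).eval t = 0) : G.eval t = u t :=
  (eval_hermiteNodal_eq_zero_iff.1 ht).elim (hG.eval_simple t) (hG.eval_double t)

lemma natDegree_add_C_mul_hermiteNodal_le (hG : IsHermiteInterpolant A B u u' G) (c : F) :
    (G + C c * hermiteNodal A B).natDegree ≤ A.card + 2 * B.card :=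
  natDegree_add_le_of_degree_le (natDegree_le_of_degree_le hG.degree_lt.le)
    ((natDegree_C_mul_le _ _).trans (natDegree_hermiteNodal A B).le)

lemma coeff_add_C_mul_hermiteNodal (hG : IsHermiteInterpolant A B u u' G) (c : F) :
    (G + C c * hermiteNodal A B).coeff (A.card + 2 * B.card) = c := by
  rw [coeff_add, coeff_eq_zero_of_degree_lt hG.degree_lt, coeff_C_mul, ← natDegree_hermiteNodal,
    (hermiteNodal_monic A B).coeff_natDegree, zero_add, mul_one]

end IsHermiteInterpolant

theorem IsHermiteInterpolant.exists_sub_eval_eq {s : Set ℝ} {A B : Finset ℝ} {h : ℝ → ℝ} {n : ℕ}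
    {G : ℝ[X]} (hG : IsHermiteInterpolant A B h (deriv h) G) (hs : s.OrdConnected)
    (hs' : (interior s).Nonempty) (hc : ContinuousOn h s)
    (hd : ContDiffOn ℝ (n + 1 : ℕ) h (interior s)) (hA : ↑A ⊆ s) (hB : ↑B ⊆ interior s)
    (hAB : Disjoint A B) (hn : A.card + 2 * B.card = n + 1) {t : ℝ} (ht : t ∈ s) :
    ∃ ξ ∈ interior s, h t - G.eval t =
      iteratedDeriv (n + 1) h ξ / (n + 1).factorial * (hermiteNodal A B).eval t := by
  by_cases hWt : (hermiteNodal A B).eval t = 0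
  · obtain ⟨ξ, hξ⟩ := hs'
    exact ⟨ξ, hξ, by rw [hG.eval_eq hWt, hWt, sub_self, mul_zero]⟩
  set W := hermiteNodal A B
  set c := (h t - G.eval t) / W.eval t with hc_def
  have hWeval {z : ℝ} (hz : z ∈ A ∪ B) : W.eval z = 0 :=
    eval_hermiteNodal_eq_zero_iff.2 (Finset.mem_union.1 hz)
  have htAB : t ∉ A ∪ B := mt hWeval hWt
  -- The multiple of `W` is chosen so that the interpolant also matches `h` at `t`.
  obtain ⟨ξ, hξ, hder⟩ : ∃ ξ ∈ interior s,
      iteratedDeriv (n + 1) h ξ = (n + 1).factorial * (G + C c * W).coeff (n + 1) := by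
    refine exists_iteratedDeriv_eq_factorial_mul_coeff (Z := insert t (A ∪ B)) (D := B)
      hs hc hd ?_ ?_ hB ?_ ?_ ?_ ?_
    · rw [Finset.coe_insert, Finset.coe_union]
      exact Set.insert_subset ht (Set.union_subset hA (hB.trans interior_subset))
    · exact Finset.subset_union_right.trans (Finset.subset_insert _ _)
    · rw [Finset.card_insert_of_notMem htAB, Finset.card_union_of_disjoint hAB]
      lia
    · exact hn ▸ hG.natDegree_add_C_mul_hermiteNodal_le c
    · intro z hz
      rw [eval_add, eval_C_mul]
      rcases Finset.mem_insert.1 hz with rfl | hz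
      · rw [hc_def, div_mul_cancel₀ _ hWt, add_sub_cancel]
      · rw [hWeval hz, mul_zero, add_zero, hG.eval_eq (hWeval hz)]
    · intro z hz
      rw [derivative_add, derivative_C_mul, eval_add, eval_C_mul, eval_derivative_hermiteNodal hz,
        mul_zero, add_zero, hG.derivative_double z hz]
  have hcoeff : (G + C c * W).coeff (n + 1) = c := hn ▸ hG.coeff_add_C_mul_hermiteNodal c
  refine ⟨ξ, hξ, ?_⟩
  rw [hder, hcoeff, mul_div_cancel_left₀ _ (by positivity), hc_def, div_mul_cancel₀ _ hWt]

end Hermite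

/-! ### Inner products and energies of designs -/

lemma ip_mem_Ico {n : ℕ} {x y : Cube n} (hxy : x ≠ y) : ip x y ∈ Set.Ico (-1 : ℝ) 1 := by
  have hd : (hammingDist x y : ℝ) ≤ n := by exact_mod_cast hammingDist_le x y
  have hd0 : (0 : ℝ) < hammingDist x y := by exact_mod_cast hammingDist_pos.2 hxy
  have hn : (0 : ℝ) < n := hd0.trans_le hd
  have hle : 2 * (hammingDist x y : ℝ) / n ≤ 2 := by
    rw [div_le_iff₀ hn]
    linarith
  have hpos : 0 < 2 * (hammingDist x y : ℝ) / n := by positivity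
  constructor <;> unfold ip <;> linarith

/-- The functional `f ↦ |D|⁻¹ ∑_{y ∈ D, y ≠ x} f(⟨x,y⟩)`. On a design containing `x` it is
`f ↦ f_0 - f(1) / |D|`, so its Radau rules are the quadratures of `IsQuadrature`. -/
noncomputable def designFunctional {n : ℕ} (D : Finset (Cube n)) (x : Cube n) : ℝ[X] →ₗ[ℝ] ℝ :=
  (D.card : ℝ)⁻¹ • ∑ y ∈ D.erase x, leval (ip x y)

section DesignFunctional

variable {n k τ : ℕ} {D : Finset (Cube n)} {x : Cube n}

lemma designFunctional_apply (D : Finset (Cube n)) (x : Cube n) (f : ℝ[X]) :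
    designFunctional D x f = (D.card : ℝ)⁻¹ * ∑ y ∈ D.erase x, f.eval (ip x y) := by
  simp [designFunctional]

lemma isStrictlyPositiveOn_designFunctional (hx : x ∈ D) :
    IsStrictlyPositiveOn (designFunctional D x) ((D.erase x).image (ip x)) := by
  rintro p hp ⟨t, ht, hpt⟩
  obtain ⟨y, hy, rfl⟩ := Finset.mem_image.1 ht
  have hcard : (0 : ℝ) < D.card := by exact_mod_cast Finset.card_pos.2 ⟨x, hx⟩
  rw [designFunctional_apply]
  exact mul_pos (inv_pos.2 hcard) (Finset.sum_pos' (fun z hz => hp _ (Finset.mem_image_of_mem _ hz))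
    ⟨y, hy, lt_of_le_of_ne (hp _ ht) hpt.symm⟩)

lemma image_ip_subset_Ico (D : Finset (Cube n)) (x : Cube n) :
    ((D.erase x).image (ip x) : Set ℝ) ⊆ Set.Ico (-1) 1 := by
  rw [Finset.coe_image, Set.image_subset_iff]
  exact fun y hy => ip_mem_Ico (Finset.ne_of_mem_erase hy).symm

namespace IsDesign

lemma designFunctional_eq (hD : IsDesign τ D) (hx : x ∈ D) {f : ℝ[X]} {c : Fin (τ + 1) → ℝ}
    (hf : IsKrawExpansion n f c) : designFunctional D x f = c 0 - f.eval 1 / D.card := by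
  have hcard : (D.card : ℝ) ≠ 0 := by exact_mod_cast hD.card_pos.ne'
  have hsum := hD.sum_eval_ip hf x
  rw [← Finset.add_sum_erase _ _ hx, ip_self] at hsum
  rw [designFunctional_apply, eq_sub_of_add_eq' hsum]
  field

lemma lt_encard_image_ip (hD : IsDesign (2 * k) D) (hM : rao n (2 * k) < D.card) (hx : x ∈ D) :
    (k : ℕ∞) < ((D.erase x).image (ip x) : Set ℝ).encard := by
  rw [Set.encard_coe_eq_coe_finsetCard, Nat.cast_lt]
  by_contra! hcard
  refine hM.ne' (hD.card_eq_rao_of_eval_eq_zero hx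
    (f := Lagrange.nodal ((D.erase x).image (ip x)) id) ?_ ?_ fun y hy hyx => ?_)
  · rwa [Lagrange.natDegree_nodal]
  · exact Lagrange.eval_nodal_not_at_node fun t ht => (image_ip_subset_Ico D x ht).2.ne'
  · exact Lagrange.eval_nodal_at_node (v := id)
      (Finset.mem_image_of_mem _ (Finset.mem_erase.2 ⟨hyx, hy⟩))

theorem isQuadrature_iff (hD : IsDesign (2 * k) D) (hx : x ∈ D) {β γ : Fin (k + 1) → ℝ} :
    IsQuadrature n D.card k β γ ↔ IsRadauRule (designFunctional D x) (-1) 1 k β γ := by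
  constructor
  · rintro ⟨h0, hmono, hlt, hpos, hexact⟩
    refine ⟨h0, hmono, hlt, hpos, fun f hf => ?_⟩
    obtain ⟨c, hc, -⟩ := existsUnique_isKrawExpansion hD.strength_le hf
    rw [hD.designFunctional_eq hx hc, hexact f c hf hc, add_sub_cancel_left]
  · rintro ⟨h0, hmono, hlt, hpos, hexact⟩
    refine ⟨h0, hmono, hlt, hpos, fun f c hf hc => ?_⟩
    rw [← hexact f hf, hD.designFunctional_eq hx hc, add_sub_cancel]

theorem existsUnique_isQuadrature (hD : IsDesign (2 * k) D) (hM : rao n (2 * k) < D.card) :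
    ∃! p : (Fin (k + 1) → ℝ) × (Fin (k + 1) → ℝ), IsQuadrature n D.card k p.1 p.2 := by
  obtain ⟨x, hx⟩ := Finset.card_pos.1 hD.card_pos
  have hL := isStrictlyPositiveOn_designFunctional hx
  have hT := hD.lt_encard_image_ip hM hx
  obtain ⟨β, γ, hR⟩ := hL.exists_isRadauRule (image_ip_subset_Ico D x) hT
  refine ⟨(β, γ), (hD.isQuadrature_iff hx).2 hR, fun p hp => ?_⟩
  have huniq := ((hD.isQuadrature_iff hx).1 hp).eq_of_isStrictlyPositiveOn hR hL
    (fun t ht => (image_ip_subset_Ico D x ht).1) hT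
  exact Prod.ext huniq.1 huniq.2

lemma exists_ip_lt_node (hD : IsDesign (2 * k) D) (hM : rao n (2 * k) < D.card)
    {β γ : Fin (k + 1) → ℝ} (hQ : IsQuadrature n D.card k β γ) (i : Fin k) :
    ∃ x ∈ D, ∃ y ∈ D, x ≠ y ∧ ip x y < β i.succ := by
  obtain ⟨x, hx⟩ := Finset.card_pos.1 hD.card_pos
  obtain ⟨t, ht, hlt⟩ := ((hD.isQuadrature_iff hx).1 hQ).exists_mem_lt_node
    (isStrictlyPositiveOn_designFunctional hx) (hD.lt_encard_image_ip hM hx) i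
  obtain ⟨y, hy, rfl⟩ := Finset.mem_image.1 ht
  exact ⟨x, hx, y, Finset.mem_of_mem_erase hy, (Finset.ne_of_mem_erase hy).symm, hlt⟩

end IsDesign

end DesignFunctional

section MinIp

variable {n k M τ : ℕ}

lemma finite_setOf_ip (D : Finset (Cube n)) :
    {t : ℝ | ∃ x ∈ D, ∃ y ∈ D, x ≠ y ∧ t = ip x y}.Finite := by
  refine ((D ×ˢ D).image fun p => ip p.1 p.2).finite_toSet.subset ?_
  rintro t ⟨x, hx, y, hy, -, rfl⟩
  exact Finset.mem_coe.2 (Finset.mem_image.2 ⟨(x, y), Finset.mem_product.2 ⟨hx, hy⟩, rfl⟩)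

lemma designMinIp_le {D : Finset (Cube n)} (hD : D ∈ designs n M τ) {x y : Cube n}
    (hx : x ∈ D) (hy : y ∈ D) (hxy : x ≠ y) : designMinIp n M τ ≤ ip x y :=
  (csInf_le (Set.toFinite _).bddBelow (Set.mem_image_of_mem _ hD)).trans
    (csInf_le (finite_setOf_ip D).bddBelow ⟨x, hx, y, hy, hxy, rfl⟩)

lemma exists_designMinIp_eq (hne : (designs n M τ).Nonempty) (hM : 1 < M) :
    ∃ D ∈ designs n M τ, ∃ x ∈ D, ∃ y ∈ D, x ≠ y ∧ designMinIp n M τ = ip x y := by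
  obtain ⟨D, hD, hDeq⟩ := (hne.image minIp).csInf_mem (Set.toFinite _)
  obtain ⟨x, hx, y, hy, hxy⟩ := Finset.one_lt_card.1 (hD.2.symm ▸ hM : 1 < D.card)
  obtain ⟨x', hx', y', hy', hxy', hmin⟩ :=
    Set.Nonempty.csInf_mem (s := {t : ℝ | ∃ x ∈ D, ∃ y ∈ D, x ≠ y ∧ t = ip x y})
      ⟨ip x y, x, hx, y, hy, hxy, rfl⟩ (finite_setOf_ip D)
  exact ⟨D, hD, x', hx', y', hy', hxy', hDeq.symm.trans hmin⟩

lemma designMinIp_mem_Ico (hne : (designs n M τ).Nonempty) (hM : 1 < M) :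
    designMinIp n M τ ∈ Set.Ico (-1 : ℝ) 1 := by
  obtain ⟨_, -, x, -, y, -, hxy, hl⟩ := exists_designMinIp_eq hne hM
  exact hl ▸ ip_mem_Ico hxy

lemma designMinIp_lt_node (hne : (designs n M (2 * k)).Nonempty) (hM : rao n (2 * k) < M)
    {β γ : Fin (k + 1) → ℝ} (hQ : IsQuadrature n M k β γ) (i : Fin k) :
    designMinIp n M (2 * k) < β i.succ := by
  obtain ⟨D, hD, rfl⟩ := hne
  obtain ⟨x, hx, y, hy, hxy, hlt⟩ := hD.exists_ip_lt_node hM hQ i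
  exact (designMinIp_le ⟨hD, rfl⟩ hx hy hxy).trans_lt hlt

theorem neg_one_lt_designMinIp (hne : (designs n M (2 * k)).Nonempty) (hM : 1 < M)
    (hM' : M < rao n (2 * k + 1)) : -1 < designMinIp n M (2 * k) := by
  obtain ⟨D, hD, x, hx, y, hy, -, hl⟩ := exists_designMinIp_eq hne hM
  refine lt_of_le_of_ne (designMinIp_mem_Ico hne hM).1 fun hl' => hM'.not_ge ?_
  rw [← hD.2]
  exact hD.1.rao_le_card_of_antipodal hx hy (hl'.trans hl).symm

lemma one_le_rao_two_mul (n k : ℕ) : 1 ≤ rao n (2 * k) := by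
  rw [rao_two_mul, Finset.sum_range_succ', Nat.choose_zero_right]
  exact Nat.le_add_left _ _

end MinIp

section Energy

variable {n M τ : ℕ} {f : ℝ[X]} {c : Fin (τ + 1) → ℝ} {h : ℝ → ℝ}

theorem IsDesign.energy_eval {D : Finset (Cube n)} (hD : IsDesign τ D)
    (hf : IsKrawExpansion n f c) :
    energy (fun t => f.eval t) D = c 0 * D.card - f.eval 1 := by
  have hcard : (D.card : ℝ) ≠ 0 := by exact_mod_cast hD.card_pos.ne'
  have hsum : ∑ p ∈ D ×ˢ D, f.eval (ip p.1 p.2) = D.card * (D.card * c 0) := by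
    rw [Finset.sum_product, Finset.sum_congr rfl fun x _ => hD.sum_eval_ip hf x,
      Finset.sum_const, nsmul_eq_mul]
  rw [← Finset.diag_union_offDiag, Finset.sum_union (Finset.disjoint_diag_offDiag D),
    Finset.sum_diag] at hsum
  simp only [ip_self, Finset.sum_const, nsmul_eq_mul] at hsum
  rw [energy, eq_sub_of_add_eq' hsum]
  field

lemma energy_le_energy {g : ℝ → ℝ} {D : Finset (Cube n)}
    (hgh : ∀ x ∈ D, ∀ y ∈ D, x ≠ y → g (ip x y) ≤ h (ip x y)) : energy g D ≤ energy h D := by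
  refine mul_le_mul_of_nonneg_left (Finset.sum_le_sum fun p hp => ?_) (by positivity)
  obtain ⟨hx, hy, hxy⟩ := Finset.mem_offDiag.1 hp
  exact hgh _ hx _ hy hxy

theorem le_minDesignEnergy (hf : IsKrawExpansion n f c)
    (hfh : ∀ t ∈ Set.Ico (-1 : ℝ) 1, designMinIp n M τ ≤ t → f.eval t ≤ h t) :
    ((c 0 * M - f.eval 1 : ℝ) : EReal) ≤ minDesignEnergy n M τ h := by
  refine le_iInf₂ fun D hD => ?_
  rw [EReal.coe_le_coe_iff, ← hD.2, ← hD.1.energy_eval hf]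
  exact energy_le_energy fun x hx y hy hxy => hfh _ (ip_mem_Ico hxy) (designMinIp_le hD hx hy hxy)

end Energy

section Quadrature

variable {n M k : ℕ} {β γ : Fin (k + 1) → ℝ} {f : ℝ[X]} {c : Fin (2 * k + 1) → ℝ} {h : ℝ → ℝ}

namespace IsQuadrature

lemma injective_tail (hQ : IsQuadrature n M k β γ) : Function.Injective fun i : Fin k => β i.succ :=
  hQ.strictMono.injective.comp (Fin.succ_injective k)

lemma node_succ_mem_Ioo (hQ : IsQuadrature n M k β γ) (i : Fin k) :
    β i.succ ∈ Set.Ioo (-1 : ℝ) 1 :=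
  ⟨hQ.zero_node ▸ hQ.strictMono i.succ_pos, hQ.lt_one _⟩

lemma coeff_zero_mul_sub_eval_one (hQ : IsQuadrature n M k β γ) (hM : M ≠ 0)
    (hf : f.natDegree ≤ 2 * k) (hc : IsKrawExpansion n f c) :
    c 0 * M - f.eval 1 = M * ∑ i, γ i * f.eval (β i) := by
  have hM' : (M : ℝ) ≠ 0 := Nat.cast_ne_zero.2 hM
  rw [hQ.exact f c hf hc]
  field

lemma mul_sum_le (hQ : IsQuadrature n M k β γ) (hM : M ≠ 0) (hf : f.natDegree ≤ 2 * k)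
    (hc : IsKrawExpansion n f c) (hle : ∀ i, h (β i) ≤ f.eval (β i)) :
    M * ∑ i, γ i * h (β i) ≤ c 0 * M - f.eval 1 := by
  rw [hQ.coeff_zero_mul_sub_eval_one hM hf hc]
  exact mul_le_mul_of_nonneg_left (Finset.sum_le_sum fun i _ =>
    mul_le_mul_of_nonneg_left (hle i) (hQ.weight_pos i).le) M.cast_nonneg

lemma mul_sum_lt (hQ : IsQuadrature n M k β γ) (hM : M ≠ 0) (hf : f.natDegree ≤ 2 * k)
    (hc : IsKrawExpansion n f c) (hle : ∀ i, h (β i) ≤ f.eval (β i))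
    (hlt : ∃ i, h (β i) < f.eval (β i)) : M * ∑ i, γ i * h (β i) < c 0 * M - f.eval 1 := by
  rw [hQ.coeff_zero_mul_sub_eval_one hM hf hc]
  obtain ⟨i, hi⟩ := hlt
  exact mul_lt_mul_of_pos_left (Finset.sum_lt_sum
    (fun j _ => mul_le_mul_of_nonneg_left (hle j) (hQ.weight_pos j).le)
    ⟨i, Finset.mem_univ i, mul_lt_mul_of_pos_left hi (hQ.weight_pos i)⟩) (by positivity)

end IsQuadrature

end Quadrature

section Interpolation

variable {k : ℕ} {h : ℝ → ℝ} {l a b t : ℝ} {β : Fin (k + 1) → ℝ} {G : ℝ[X]}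

lemma isHermite_iff (hβ : Function.Injective fun i : Fin k => β i.succ) :
    IsHermite h l β G ↔
      IsHermiteInterpolant {l} (Finset.univ.image fun i : Fin k => β i.succ) h (deriv h) G := by
  have hdeg : G.degree < (Finset.card {l} + 2 * (Finset.univ.image fun i : Fin k => β i.succ).card
      : ℕ) ↔ G.natDegree ≤ 2 * k := by
    rw [Finset.card_image_of_injective _ hβ, Finset.card_singleton, Finset.card_univ,
      Fintype.card_fin, add_comm 1, ← mem_degreeLT, mem_degreeLT_succ]
  constructor
  · rintro ⟨h1, h2, h3, h4⟩
    exact ⟨hdeg.2 h1, by simpa using h2, by simpa using h3, by simpa using h4⟩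
  · rintro ⟨h1, h2, h3, h4⟩
    exact ⟨hdeg.1 h1, by simpa using h2, by simpa using h3, by simpa using h4⟩

lemma disjoint_singleton_image_succ (hlβ : ∀ i : Fin k, l ≠ β i.succ) :
    Disjoint {l} (Finset.univ.image fun i : Fin k => β i.succ) := by
  simpa [eq_comm] using hlβ

theorem existsUnique_isHermite (h : ℝ → ℝ) (hβ : Function.Injective fun i : Fin k => β i.succ)
    (hlβ : ∀ i : Fin k, l ≠ β i.succ) : ∃! G, IsHermite h l β G := by
  simpa only [isHermite_iff hβ] using
    existsUnique_isHermiteInterpolant (disjoint_singleton_image_succ hlβ) h (deriv h)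

namespace IsHermite

theorem exists_sub_eval_eq (hG : IsHermite h l β G)
    (hβ : Function.Injective fun i : Fin k => β i.succ) (hlβ : ∀ i : Fin k, l ≠ β i.succ)
    (hβab : ∀ i : Fin k, β i.succ ∈ Set.Ioo a b) (hl : l ∈ Set.Ico a b)
    (hc : ContinuousOn h (Set.Ico a b)) (hd : ContDiffOn ℝ (2 * k + 1 : ℕ) h (Set.Ioo a b))
    (ht : t ∈ Set.Ico a b) :
    ∃ ξ ∈ Set.Ioo a b, h t - G.eval t = iteratedDeriv (2 * k + 1) h ξ / (2 * k + 1).factorial *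
      ((t - l) * (∏ i : Fin k, (t - β i.succ)) ^ 2) := by
  have hs : interior (Set.Ico a b) = Set.Ioo a b := interior_Ico
  obtain ⟨ξ, hξ, hsub⟩ := ((isHermite_iff hβ).1 hG).exists_sub_eval_eq (n := 2 * k)
    Set.ordConnected_Ico (hs ▸ Set.nonempty_Ioo.2 (hl.1.trans_lt hl.2)) hc (hs ▸ hd)
    (by simpa using hl) (by simpa [hs, Set.range_subset_iff] using hβab)
    (disjoint_singleton_image_succ hlβ)
    (by rw [Finset.card_image_of_injective _ hβ, Finset.card_singleton, Finset.card_univ,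
      Fintype.card_fin, add_comm]) ht
  refine ⟨ξ, hs ▸ hξ, ?_⟩
  rwa [eval_hermiteNodal, Finset.prod_singleton, Finset.prod_image hβ.injOn] at hsub

variable (hG : IsHermite h l β G) (hβ : Function.Injective fun i : Fin k => β i.succ)
  (hlβ : ∀ i : Fin k, l ≠ β i.succ) (hβab : ∀ i : Fin k, β i.succ ∈ Set.Ioo a b)
  (hl : l ∈ Set.Ico a b) (hc : ContinuousOn h (Set.Ico a b))
  (hd : ContDiffOn ℝ (2 * k + 1 : ℕ) h (Set.Ioo a b))
include hG hβ hlβ hβab hl hc hd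

lemma eval_le_of_ge (hnonneg : ∀ t ∈ Set.Ioo a b, 0 ≤ iteratedDeriv (2 * k + 1) h t)
    (ht : t ∈ Set.Ico a b) (hlt : l ≤ t) : G.eval t ≤ h t := by
  obtain ⟨ξ, hξ, hsub⟩ := hG.exists_sub_eval_eq hβ hlβ hβab hl hc hd ht
  rw [← sub_nonneg, hsub]
  exact mul_nonneg (div_nonneg (hnonneg ξ hξ) (Nat.cast_nonneg _))
    (mul_nonneg (sub_nonneg.2 hlt) (sq_nonneg _))

lemma le_eval_of_le (hnonneg : ∀ t ∈ Set.Ioo a b, 0 ≤ iteratedDeriv (2 * k + 1) h t)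
    (ht : t ∈ Set.Ico a b) (htl : t ≤ l) : h t ≤ G.eval t := by
  obtain ⟨ξ, hξ, hsub⟩ := hG.exists_sub_eval_eq hβ hlβ hβab hl hc hd ht
  rw [← sub_nonpos, hsub]
  exact mul_nonpos_of_nonneg_of_nonpos (div_nonneg (hnonneg ξ hξ) (Nat.cast_nonneg _))
    (mul_nonpos_of_nonpos_of_nonneg (sub_nonpos.2 htl) (sq_nonneg _))

lemma lt_eval_of_lt (hpos : ∀ t ∈ Set.Ioo a b, 0 < iteratedDeriv (2 * k + 1) h t)
    (ht : t ∈ Set.Ico a b) (htl : t < l) (htβ : ∀ i : Fin k, t ≠ β i.succ) :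
    h t < G.eval t := by
  obtain ⟨ξ, hξ, hsub⟩ := hG.exists_sub_eval_eq hβ hlβ hβab hl hc hd ht
  rw [← sub_neg, hsub]
  exact mul_neg_of_pos_of_neg (div_pos (hpos ξ hξ) (Nat.cast_pos.2 (Nat.factorial_pos _)))
    (mul_neg_of_neg_of_pos (sub_neg.2 htl)
      (sq_pos_of_ne_zero (Finset.prod_ne_zero_iff.2 fun i _ => sub_ne_zero.2 (htβ i))))

end IsHermite

end Interpolation

section AbsolutelyMonotone

variable {h : ℝ → ℝ} {a b ξ : ℝ}

lemma iteratedDerivWithin_Ico_eq_iteratedDeriv {m : ℕ} (hh : ContDiffOn ℝ m h (Set.Ico a b))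
    (hξ : ξ ∈ Set.Ioo a b) : iteratedDerivWithin m h (Set.Ico a b) ξ = iteratedDeriv m h ξ :=
  iteratedDerivWithin_eq_iteratedDeriv (uniqueDiffOn_Ico a b)
    (hh.contDiffAt (Ico_mem_nhds hξ.1 hξ.2)) (Set.Ioo_subset_Ico_self hξ)

lemma iteratedDeriv_nonneg_of_absolutelyMonotoneOn (hh : AbsolutelyMonotoneOn h (Set.Ico a b))
    (m : ℕ) (hξ : ξ ∈ Set.Ioo a b) : 0 ≤ iteratedDeriv m h ξ := by
  rw [← iteratedDerivWithin_Ico_eq_iteratedDeriv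
    (contDiffOn_infty.1 hh.contDiffOn m) hξ]
  exact hh.iteratedDerivWithin_nonneg (uniqueDiffOn_Ico a b) m (Set.Ioo_subset_Ico_self hξ)

lemma StrictlyAbsolutelyMonotoneOn.iteratedDeriv_pos
    (hh : StrictlyAbsolutelyMonotoneOn h (Set.Ico a b)) (m : ℕ) (hξ : ξ ∈ Set.Ioo a b) :
    0 < iteratedDeriv m h ξ := by
  rw [← iteratedDerivWithin_Ico_eq_iteratedDeriv (contDiffOn_infty.1 hh.1 m) hξ]
  exact hh.2 m ξ (Set.Ioo_subset_Ico_self hξ)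

end AbsolutelyMonotone

end HammingEnergy

theorem mainTheorem5_general (n k M : ℕ) (hM : rao n (2 * k) < M)
    (hdesign : (designs n M (2 * k)).Nonempty) (h : ℝ → ℝ)
    (hc : ContinuousOn h (Set.Ico (-1) 1)) (hd : ContDiffOn ℝ (2 * k + 1 : ℕ) h (Set.Ioo (-1) 1))
    (hnonneg : ∀ t ∈ Set.Ioo (-1 : ℝ) 1, 0 ≤ iteratedDeriv (2 * k + 1) h t) :
    (∃! p : (Fin (k + 1) → ℝ) × (Fin (k + 1) → ℝ), IsQuadrature n M k p.1 p.2) ∧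
    ∀ β γ : Fin (k + 1) → ℝ, IsQuadrature n M k β γ →
      (∃! G : ℝ[X], IsHermite h (designMinIp n M (2 * k)) β G) ∧
      ∀ G : ℝ[X], IsHermite h (designMinIp n M (2 * k)) β G →
        (∃! c : Fin (2 * k + 1) → ℝ, IsKrawExpansion n G c) ∧
        ∀ c : Fin (2 * k + 1) → ℝ, IsKrawExpansion n G c →
          ((c 0 * M - G.eval 1 : ℝ) : EReal) ≤ minDesignEnergy n M (2 * k) h ∧
          M * ∑ i, γ i * h (β i) ≤ c 0 * M - G.eval 1 ∧
          (M < rao n (2 * k + 1) →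
            (∀ t ∈ Set.Ioo (-1 : ℝ) 1, 0 < iteratedDeriv (2 * k + 1) h t) →
            M * ∑ i, γ i * h (β i) < c 0 * M - G.eval 1) := by
  obtain ⟨D, hD, rfl⟩ := id hdesign
  have hM1 : 1 < D.card := (one_le_rao_two_mul n k).trans_lt hM
  have hl := designMinIp_mem_Ico hdesign hM1
  refine ⟨hD.existsUnique_isQuadrature hM, fun β γ hQ => ?_⟩
  have hβ := hQ.injective_tail
  have hβ1 := hQ.node_succ_mem_Ioo
  have hlβ (i : Fin k) := (designMinIp_lt_node hdesign hM hQ i).ne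
  refine ⟨existsUnique_isHermite h hβ hlβ, fun G hG =>
    ⟨existsUnique_isKrawExpansion hD.strength_le hG.natDegree_le, fun c hcG => ?_⟩⟩
  have hle : ∀ i, h (β i) ≤ G.eval (β i) := Fin.cases
    (hQ.zero_node ▸ hG.le_eval_of_le hβ hlβ hβ1 hl hc hd hnonneg (by norm_num) hl.1)
    fun i => (hG.eval_node i).ge
  refine ⟨le_minDesignEnergy hcG fun t => hG.eval_le_of_ge hβ hlβ hβ1 hl hc hd hnonneg,
    hQ.mul_sum_le hD.card_pos.ne' hG.natDegree_le hcG hle, fun hM' hpos =>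
    hQ.mul_sum_lt hD.card_pos.ne' hG.natDegree_le hcG hle ⟨0, ?_⟩⟩
  rw [hQ.zero_node]
  exact hG.lt_eval_of_lt hβ hlβ hβ1 hl hc hd hpos (by norm_num)
    (neg_one_lt_designMinIp hdesign hM1 hM') fun i => (hβ1 i).1.ne

theorem mainTheorem5 (n k M : ℕ) (hn : 0 < n) (hk : 0 < k)
    (hM : rao n (2 * k) < M) (hM' : M < rao n (2 * k + 1))
    (hdesign : (designs n M (2 * k)).Nonempty)
    (h : ℝ → ℝ) (hh : AbsolutelyMonotoneOn h (Set.Ico (-1) 1)) :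
    (∃! p : (Fin (k + 1) → ℝ) × (Fin (k + 1) → ℝ), IsQuadrature n M k p.1 p.2) ∧
    ∀ β γ : Fin (k + 1) → ℝ, IsQuadrature n M k β γ →
      (∃! G : ℝ[X], IsHermite h (designMinIp n M (2 * k)) β G) ∧
      ∀ G : ℝ[X], IsHermite h (designMinIp n M (2 * k)) β G →
        (∃! c : Fin (2 * k + 1) → ℝ, IsKrawExpansion n G c) ∧
        ∀ c : Fin (2 * k + 1) → ℝ, IsKrawExpansion n G c →
          ((c 0 * M - G.eval 1 : ℝ) : EReal) ≤ minDesignEnergy n M (2 * k) h ∧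
          M * ∑ i, γ i * h (β i) ≤ c 0 * M - G.eval 1 ∧
          (StrictlyAbsolutelyMonotoneOn h (Set.Ico (-1) 1) →
            M * ∑ i, γ i * h (β i) < c 0 * M - G.eval 1) := by
  refine (mainTheorem5_general n k M hM hdesign h hh.contDiffOn.continuousOn
    ((contDiffOn_infty.1 hh.contDiffOn _).mono Set.Ioo_subset_Ico_self)
    fun t ht => iteratedDeriv_nonneg_of_absolutelyMonotoneOn hh _ ht).imp_right
    fun H β γ hQ => (H β γ hQ).imp_right fun H G hG => (H G hG).imp_right fun H c hc => ?_
  exact (H c hc).imp_right (And.imp_right fun H hs => H hM' fun t ht => hs.iteratedDeriv_pos _ ht)
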